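/- **Setting.** Let $(\mathcal S,\mathcal S^{\rm init},\mathcal S^{\rm end},\mathcal A,P,R,\Gamma)$ be a finite Markov decision process: $\mathcal S$ and $\mathcal A\subseteq\mathcal A_1\times\dots\times\mathcal A_K$ are finite, $\mathcal S^{\rm init}\subseteq\mathcal S\setminus\mathcal S^{\rm end}$, and $\mathcal A(s)\subseteq\mathcal A$ is the set of actions available in $s$, with $\mathcal A=\bigcup_s\mathcal A(s)$. Each factor $\mathcal A_k$ contains an ending element. $\mathcal A^{\rm end}$ is the set of actions with at least one ending coordinate; it is contained in every $\mathcal A(s)$, and the tuple of all ending elements belongs to $\mathcal A$. The transition probabilities satisfy $P(s,a,s')\ge 0$ and $\sum_{s'}P(s,a,s')\le 1$ (missing mass is the probability that the run is lost and never stops at a state), the rewards are $R(s,a,s')\in\mathbb R$, and the discounts are $\Gamma(s,a,s')\in[0,1]$; $R$ and $\Gamma$ matter only where $P(s,a,s')>0$. For $a\in\mathcal A^{\rm end}$ one has $P(s,a,s')=\mathbf 1_{\{s'=s\}}$ and $\Gamma(s,a,s)=1$, and $R(s,a,s)=r$ if $s\notin\mathcal S^{\rm end}$, where $r<0$ is a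 constant; moreover $R(s,\cdot,\cdot)=0$ for $s\in\mathcal S^{\rm end}$. Let $\pi$ be a policy, i.e. $\pi(s,a)\ge 0$ and $\sum_{a\in\mathcal A(s)}\pi(s,a)=1$ for every $s$, with $\sum_{a\in\mathcal A^{\rm end}}\pi(s,a)=1$ for $s\in\mathcal S^{\rm end}$, and let $t\in[1,\infty]$ be its timescale, with $1/\infty:=0$. **Compressed quantities.** Run $\pi$ from $S_0=s$: given $S_n$, draw $A_{n+1}\sim\pi(S_n,\cdot)$ and then $S_{n+1}\sim P(S_n,A_{n+1},\cdot)$. Let $\tau_0$ be independent of the run and geometric on $\{1,2,\dots\}$ with parameter $1/t$ ($\tau_0=\infty$ if $t=\infty$), and let $\tau=\min\{\tau_0,\min\{n:A_n\in\mathcal A^{\rm end}\}\}$. Put $$P^+(s,\pi,s')=\mathbb P[\tau<\infty,\ S_\tau=s'\mid S_0=s],\qquad R_{0,\tau}=\sum_{n=0}^{\tau-1}\Big[\prod_{m=0}^{n-1}\Gamma(S_m,A_{m+1},S_{m+1})\Big]R(S_n,A_{n+1},S_{n+1}),$$ and, whenever $P^+(s,\pi,s')>0$, let $R^+(s,\pi,s')=0$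 if $s\in\mathcal S^{\rm end}$, and $R^+(s,\pi,s')=\mathbb E[R_{0,\tau}\mid S_0=s,\ \tau<\infty,\ S_\tau=s']$ otherwise. **Notation.** Let $P^\pi_{\rm end}(s,s'')=\sum_{a\in\mathcal A^{\rm end}}P(s,a,s'')\pi(s,a)$ and $[(X\circ Y)^\pi]_{s,s''}=\sum_{a\in\mathcal A(s)}X(s,a,s'')Y(s,a,s'')\pi(s,a)$. Fix $s'\in\mathcal S$, let $\mathcal S_{s'}=\{s: P^+(s,\pi,s')>0\}$, and for $s\in\mathcal S_{s'}$ put $$P_{s'}(s,a,s'')=\frac{P(s,a,s'')P^+(s'',\pi,s')}{P^+(s,\pi,s')},\qquad \overline P_{s'}(s,a,s'')=\frac{P(s,a,s'')}{P^+(s,\pi,s')}.$$ **Proposition.** For every $s'\in\mathcal S$: for each $s\in\mathcal S_{s'}$ the variable $R_{0,\tau}$ is integrable given $\{S_0=s,\tau<\infty,S_\tau=s'\}$, and $R^+(s,\pi,s')$ is its conditional expectation (also when $s\in\mathcal S^{\rm end}$). The vector $(R^+(s,\pi,s'))_{s\in\mathcal S_{s'}}$ is bounded and is the unique solution $h\in\mathbb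 R^{\mathcal S_{s'}}$ of the linear system $$\Big[1+\big(1-\tfrac1t\big)\big(P^\pi_{\rm end}-(P_{s'}\circ\Gamma)^\pi\big)\Big]h=\big(1-\tfrac1t\big)\Big[(P_{s'}\circ R)^\pi\underline 1-r\,P^\pi_{\rm end}\underline 1+r\,\mathrm{diag}\big(P^+(\cdot,\pi,s')\big)^{-1}P^\pi_{\rm end}v_{s'}\Big]+\tfrac1t(\overline P_{s'}\circ R)^\pi v_{s'},$$ whose rows are indexed by $\mathcal S_{s'}$. Here the columns of the matrices applied to $h$ and to the all-ones vector $\underline 1$ are restricted to $\mathcal S_{s'}$, and $v_{s'}\in\mathbb R^{\mathcal S}$ is the indicator vector of $s'$. -/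

import Mathlib

open MeasureTheory ProbabilityTheory
open scoped ENNReal BigOperators Matrix

noncomputable section

namespace CompressMDP

/-- A finite Markov decision process with state space `S`, set of all actions `A`, and `K` action
factors.  `coord` realizes `A` as a subset of the product of the factors, and `endElt k` is the
special element of the `k`-th factor that is used to end a policy.

Transition rows may have total mass below one: this happens for a higher-level MDP, whose actions
are policies that may run forever with positive probability.  The missing mass is the probability
that the run never comes back.

`R` and `Γ` are only meaningful at triples of positive transition probability, so that all
requirements are imposed at these triples only. -/
structure MDP (S A : Type*) [Fintype S] [DecidableEq S] [Fintype A]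
    (K : ℕ) (Factor : Fin K → Type*) where
  /-- initial states -/
  init : Set S
  /-- terminal states -/
  term : Set S
  init_disjoint : Disjoint init term
  /-- coordinates of an action in the action factors -/
  coord : A → ∀ k, Factor k
  coord_injective : Function.Injective coord
  /-- the special ending element of each factor -/
  endElt : ∀ k, Factor k
  /-- the action all of whose coordinates are the ending elements -/
  endAct : A
  endAct_coord : ∀ k, coord endAct k = endElt k
  /-- actions available in a state -/
  avail : S → Finset A
  avail_cover : ∀ a, ∃ s, a ∈ avail s
  /-- every action with at least one ending coordinate is available everywhere -/
  end_avail : ∀ s a, (∃ k, coord a k = endElt k) → a ∈ avail s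
  /-- transition probabilities -/
  P : S → A → S → ℝ
  P_nonneg : ∀ s, ∀ a ∈ avail s, ∀ s', 0 ≤ P s a s'
  P_sum_le : ∀ s, ∀ a ∈ avail s, ∑ s', P s a s' ≤ 1
  P_end : ∀ s a s', (∃ k, coord a k = endElt k) → P s a s' = if s' = s then 1 else 0
  /-- rewards -/
  R : S → A → S → ℝ
  /-- reward for choosing an ending action at a non-terminal state -/
  r : ℝ
  r_neg : r < 0
  R_term : ∀ s ∈ term, ∀ a ∈ avail s, ∀ s', 0 < P s a s' → R s a s' = 0
  R_end : ∀ s, s ∉ term → ∀ a, (∃ k, coord a k = endElt k) → ∀ s', 0 < P s a s' → R s a s' = r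
  /-- discount factors -/
  Γ : S → A → S → ℝ
  Γ_nonneg : ∀ s, ∀ a ∈ avail s, ∀ s', 0 < P s a s' → 0 ≤ Γ s a s'
  Γ_le_one : ∀ s, ∀ a ∈ avail s, ∀ s', 0 < P s a s' → Γ s a s' ≤ 1
  Γ_end : ∀ s a, (∃ k, coord a k = endElt k) → ∀ s', 0 < P s a s' → Γ s a s' = 1

variable {S A : Type*} [Fintype S] [DecidableEq S] [Fintype A]
  {K : ℕ} {Factor : Fin K → Type*}

/-- Actions with at least one coordinate equal to the ending element. -/
def MDP.IsEnd (M : MDP S A K Factor) (a : A) : Prop := ∃ k, M.coord a k = M.endElt k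

open Classical in
/-- The finite set of all ending actions. -/
def MDP.endActions (M : MDP S A K Factor) : Finset A := Finset.univ.filter M.IsEnd

/-- A policy: a probability on the available actions of each state, which selects ending actions
only at the terminal states. -/
structure Policy (M : MDP S A K Factor) where
  prob : S → A → ℝ
  nonneg : ∀ s, ∀ a ∈ M.avail s, 0 ≤ prob s a
  sum_eq_one : ∀ s, ∑ a ∈ M.avail s, prob s a = 1
  sum_end : ∀ s ∈ M.term, ∑ a ∈ M.endActions, prob s a = 1

/-! ### The run of a policy -/

/-- What is recorded at time `n`: the action `A_n` that led to the state `S_n`, and `S_n` itself.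
The action is `none` at time `0` and once the run is lost, and the state is `none` once the run is
lost, i.e. has left the state space through missing transition mass. -/
@[ext]
structure Obs (S A : Type*) where
  action : Option A
  state : Option S

instance : MeasurableSpace (Obs S A) := ⊤

instance : DiscreteMeasurableSpace (Obs S A) := ⟨fun _ => trivial⟩

/-- Law of the next record `(A_{n+1}, S_{n+1})` given the current one. -/
def stepMeasure (M : MDP S A K Factor) (π : Policy M) (x : Obs S A) : Measure (Obs S A) :=
  match x.state with
  | none => Measure.dirac ⟨none, none⟩
  | some s => ∑ a ∈ M.avail s, ENNReal.ofReal (π.prob s a) •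
      (∑ s'', ENNReal.ofReal (M.P s a s'') • Measure.dirac (⟨some a, some s''⟩ : Obs S A)
        + ENNReal.ofReal (1 - ∑ s'', M.P s a s'') • Measure.dirac (⟨some a, none⟩ : Obs S A))

theorem isProbabilityMeasure_stepMeasure (M : MDP S A K Factor) (π : Policy M) (x : Obs S A) :
    IsProbabilityMeasure (stepMeasure M π x) := by
  constructor
  unfold stepMeasure
  split
  · simp
  · rename_i s _
    have h : ∀ a ∈ M.avail s, ENNReal.ofReal (π.prob s a) *
        (∑ s'', ENNReal.ofReal (M.P s a s'') + ENNReal.ofReal (1 - ∑ s'', M.P s a s''))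
        = ENNReal.ofReal (π.prob s a) := by
      intro a ha
      rw [← ENNReal.ofReal_sum_of_nonneg (fun s'' _ => M.P_nonneg s a ha s''),
        ← ENNReal.ofReal_add (Finset.sum_nonneg fun s'' _ => M.P_nonneg s a ha s'')
          (sub_nonneg.2 (M.P_sum_le s a ha))]
      simp
    simp only [Measure.coe_finsetSum, Finset.sum_apply, Measure.smul_apply, Measure.add_apply,
      smul_eq_mul, measure_univ, mul_one]
    rw [Finset.sum_congr rfl h, ← ENNReal.ofReal_sum_of_nonneg (π.nonneg s), π.sum_eq_one s]
    simp

/-- One step of the run, as a Markov kernel. -/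
def stepKernel (M : MDP S A K Factor) (π : Policy M) : Kernel (Obs S A) (Obs S A) where
  toFun := stepMeasure M π
  measurable' := Measurable.of_discrete

instance (M : MDP S A K Factor) (π : Policy M) : IsMarkovKernel (stepKernel M π) :=
  ⟨isProbabilityMeasure_stepMeasure M π⟩

/-- The step kernel as a function of the whole history up to time `n`. -/
def histKernel (M : MDP S A K Factor) (π : Policy M) (n : ℕ) :
    Kernel (∀ _ : Finset.Iic n, Obs S A) (Obs S A) :=
  (stepKernel M π).comap (fun x => x ⟨n, Finset.mem_Iic.2 le_rfl⟩) (measurable_pi_apply _)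

instance (M : MDP S A K Factor) (π : Policy M) (n : ℕ) : IsMarkovKernel (histKernel M π n) := by
  unfold histKernel; infer_instance

/-- Law of the infinite trajectory `((A_n, S_n))_n` with `S_0 = s`. -/
def trajMeasure (M : MDP S A K Factor) (π : Policy M) (s : S) : Measure (ℕ → Obs S A) :=
  Kernel.traj (X := fun _ => Obs S A) (histKernel M π) 0 (fun _ => ⟨none, some s⟩)

/-- Stopping probability `1 / t` per step of a timescale `t ∈ [1, ∞]`, with `1 / ∞ = 0`. -/
def stopProb (t : ℝ≥0∞) : ℝ := (t⁻¹).toReal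

/-- Geometric law on `{1, 2, …}` with parameter `q`; the point mass at `∞` if `q = 0`. -/
def geoMeasure (q : ℝ) : Measure ℕ∞ :=
  if q = 0 then Measure.dirac ⊤
  else Measure.sum fun n : ℕ =>
    ENNReal.ofReal ((1 - q) ^ n * q) • Measure.dirac ((n + 1 : ℕ) : ℕ∞)

/-- Joint law of the trajectory started at `s` and of the independent geometric time `τ₀`. -/
def runMeasure (M : MDP S A K Factor) (π : Policy M) (t : ℝ≥0∞) (s : S) :
    Measure ((ℕ → Obs S A) × ℕ∞) :=
  (trajMeasure M π s).prod (geoMeasure (stopProb t))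

/-- The first time `n` at which the action `A_n` is an ending one (`∞` if there is none). -/
def firstEnd (M : MDP S A K Factor) (x : ℕ → Obs S A) : ℕ∞ :=
  ⨅ (n : ℕ) (_ : ∃ a, (x n).action = some a ∧ M.IsEnd a), (n : ℕ∞)

/-- The time `τ = min (τ₀, first time an ending action is chosen)`. -/
def stopTime (M : MDP S A K Factor) (ω : (ℕ → Obs S A) × ℕ∞) : ℕ∞ := min ω.2 (firstEnd M ω.1)

/-- The event `{τ < ∞, S_τ = s'}`. -/
def stopsAt (M : MDP S A K Factor) (s' : S) : Set ((ℕ → Obs S A) × ℕ∞) :=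
  {ω | ∃ n : ℕ, stopTime M ω = n ∧ (ω.1 n).state = some s'}

/-- The value `F (S_n, A_{n+1}, S_{n+1})` of a function of triples along a trajectory. -/
def along (F : S → A → S → ℝ) (x : ℕ → Obs S A) (n : ℕ) : ℝ :=
  match (x n).state, (x (n + 1)).action, (x (n + 1)).state with
  | some s, some a, some s'' => F s a s''
  | _, _, _ => 0

/-- The discounted reward accumulated over `[T, T']`. -/
def cumReward (M : MDP S A K Factor) (x : ℕ → Obs S A) (T T' : ℕ) : ℝ :=
  ∑ n ∈ Finset.Ico T T', (∏ m ∈ Finset.Ico T n, along M.Γ x m) * along M.R x n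

/-- `R_{0,τ}`.  (The value where `τ = ∞` plays no role.) -/
def stoppedReward (M : MDP S A K Factor) (ω : (ℕ → Obs S A) × ℕ∞) : ℝ :=
  cumReward M ω.1 0 (stopTime M ω).toNat

/-! ### The compressed quantities -/

/-- Compressed transition probability `P⁺(s, π, s')`: the probability that the run of `π` from `s`
stops at `s'`. -/
def compP (M : MDP S A K Factor) (π : Policy M) (t : ℝ≥0∞) (s s' : S) : ℝ :=
  (runMeasure M π t s (stopsAt M s')).toReal

/-- The expectation of `R_{0,τ}` for the run of `π` from `s`, given `S_τ = s'`. -/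
def condReward (M : MDP S A K Factor) (π : Policy M) (t : ℝ≥0∞) (s s' : S) : ℝ :=
  ∫ ω, stoppedReward M ω ∂(ProbabilityTheory.cond (runMeasure M π t s) (stopsAt M s'))

open Classical in
/-- Compressed reward `R⁺(s, π, s')`: zero at the terminal states, and otherwise the conditional
expectation of `R_{0,τ}` given `S_τ = s'`. -/
def compR (M : MDP S A K Factor) (π : Policy M) (t : ℝ≥0∞) (s s' : S) : ℝ :=
  if s ∈ M.term then 0 else condReward M π t s s'

/-! ### The linear system -/

/-- The transition matrix of `π` restricted to the ending actions. -/
def endMatrix (M : MDP S A K Factor) (π : Policy M) : Matrix S S ℝ :=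
  Matrix.of fun s s' => ∑ a ∈ M.endActions, M.P s a s' * π.prob s a

/-- The matrix `(X ∘ Y)^π`: the `π`-average of the pointwise product. -/
def hadamardAvg (M : MDP S A K Factor) (π : Policy M) (X Y : S → A → S → ℝ) : Matrix S S ℝ :=
  Matrix.of fun s s' => ∑ a ∈ M.avail s, X s a s' * Y s a s' * π.prob s a

/-- `P_{s'}(s, a, s'') = P(s, a, s'') P⁺(s'', π, s') / P⁺(s, π, s')`. -/
def doobP (M : MDP S A K Factor) (π : Policy M) (t : ℝ≥0∞) (s' : S) : S → A → S → ℝ :=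
  fun s a s'' => M.P s a s'' * compP M π t s'' s' / compP M π t s s'

/-- `P̄_{s'}(s, a, s'') = P(s, a, s'') / P⁺(s, π, s')`. -/
def doobPbar (M : MDP S A K Factor) (π : Policy M) (t : ℝ≥0∞) (s' : S) : S → A → S → ℝ :=
  fun s a s'' => M.P s a s'' / compP M π t s s'

/-- The states from which stopping at `s'` has positive probability. -/
abbrev Supp (M : MDP S A K Factor) (π : Policy M) (t : ℝ≥0∞) (s' : S) : Type _ :=
  {s : S // 0 < compP M π t s s'}

/-- Restriction of a matrix to the rows and columns in the support. -/
def restrictSq (M : MDP S A K Factor) (π : Policy M) (t : ℝ≥0∞) (s' : S) (B : Matrix S S ℝ) :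
    Matrix (Supp M π t s') (Supp M π t s') ℝ :=
  B.submatrix Subtype.val Subtype.val

/-- Restriction of a matrix to the rows in the support. -/
def restrictRows (M : MDP S A K Factor) (π : Policy M) (t : ℝ≥0∞) (s' : S) (B : Matrix S S ℝ) :
    Matrix (Supp M π t s') S ℝ :=
  B.submatrix Subtype.val id

/-- `h` solves the linear system of the compressed reward with target state `s'`. -/
def SolvesRewardSystem (M : MDP S A K Factor) (π : Policy M) (t : ℝ≥0∞) (s' : S)
    (h : Supp M π t s' → ℝ) : Prop :=
  (1 + (1 - stopProb t) • (restrictSq M π t s' (endMatrix M π)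
      - restrictSq M π t s' (hadamardAvg M π (doobP M π t s') M.Γ))) *ᵥ h
  = (1 - stopProb t) • (restrictSq M π t s' (hadamardAvg M π (doobP M π t s') M.R) *ᵥ 1
      - M.r • (restrictSq M π t s' (endMatrix M π) *ᵥ 1)
      + M.r • ((Matrix.diagonal fun s : Supp M π t s' => compP M π t s s')⁻¹ *ᵥ
          (restrictRows M π t s' (endMatrix M π) *ᵥ Pi.single s' 1)))
    + stopProb t •
      (restrictRows M π t s' (hadamardAvg M π (doobPbar M π t s') M.R) *ᵥ Pi.single s' 1)

end CompressMDP

end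

/-! Write q = 1/t, u_n(s) for the probability that the run from s stops at s' at time n + 1, and U =
∑ u_n for P⁺(·, π, s'). For a function F of triples let B_F be the operator that averages over the
non-ending transitions with weight F, and put L = (1 - q) B_1. Conditioning on the first step gives
u_{n+1} = L u_n, hence U = u_0 + L U (`compP_eq`). The expected rewards w_n on the same events
satisfy w_{n+1} = (1 - q)(B_R u_n + B_Γ w_n); summing, W = w_0 + (1 - q)(B_R U + B_Γ W)
(`totalReward_eq`). Since R⁺ = W/U on the support, this is the claimed system with row s multiplied
by U(s) (`solvesRewardSystem_iff`). In the matching, ending actions are self-loops with Γ = 1, so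
P_end cancels their share of the discount matrix, and the two terms with r correct their share of
the reward.

Two points are analytic, because for t = ∞ the operator L may have fixed vectors and need not
contract. Both rest on the tails T_n = U - ∑_{i<n} u_i, which satisfy T_{n+1} = L T_n and decrease
to 0.

Integrability: the reward up to time n is at most C n on paths that have positive probability, so it
suffices that ∑ (n + 1) u_n converges. As S is finite, some k has T_k ≤ T_0 / 2; monotonicity of L
gives T_{n+k} ≤ T_n / 2, so ∑ T_n converges, and Abel summation concludes
(`summable_mul_of_hasSum`).

Uniqueness: the difference D of two solutions, multiplied by U, satisfies |D| ≤ L |D| by 0 ≤ Γ ≤ 1,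
and |D| ≤ C U by finiteness. Iterating, |D| ≤ C T_n → 0 (`eq_zero_of_abs_le`). -/

noncomputable section

namespace CompressMDP

/-! ### Homogeneous Markov chains on a finite discrete space -/

section Chain

variable {E : Type*}

/-- Prepend a point to a sequence. -/
def seqCons (x : E) (z : ℕ → E) : ℕ → E
  | 0 => x
  | n + 1 => z n

@[simp] theorem seqCons_zero (x : E) (z : ℕ → E) : seqCons x z 0 = x := rfl

@[simp] theorem seqCons_succ (x : E) (z : ℕ → E) (n : ℕ) : seqCons x z (n + 1) = z n := rfl

theorem setOf_forall_le_eq_preimage (p : ℕ → E) (n : ℕ) :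
    {z : ℕ → E | ∀ i ≤ n, z i = p i} =
      Preorder.frestrictLe (π := fun _ => E) n ⁻¹' {fun i : Finset.Iic n => p i} := by
  ext z
  simp [funext_iff]

variable [MeasurableSpace E]

theorem measurable_seqCons (x : E) : Measurable (seqCons x) := by
  refine measurable_pi_lambda _ fun n => ?_
  cases n with
  | zero => exact measurable_const
  | succ n => exact measurable_pi_apply n

/-- Law of the trajectory of the homogeneous Markov chain with kernel `κ` started at `x`. -/
def chainMeasure (κ : Kernel E E) [IsMarkovKernel κ] (x : E) : Measure (ℕ → E) :=
  Kernel.traj (X := fun _ => E)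
    (fun n => κ.comap (fun y : (∀ _ : Finset.Iic n, E) => y ⟨n, Finset.mem_Iic.2 le_rfl⟩)
      (measurable_pi_apply _)) 0 (fun _ => x)

instance (κ : Kernel E E) [IsMarkovKernel κ] (x : E) :
    IsProbabilityMeasure (chainMeasure κ x) := by
  unfold chainMeasure; infer_instance

variable [DiscreteMeasurableSpace E]

/-- In the induction, the law of the path up to time n + 1 is the composition product of the law up
to time n with the kernel, and on an atom this is a plain product. These values suffice to identify
the law of a chain on a finite space. -/
theorem chainMeasure_cylinder [Countable E] [DecidableEq E] (κ : Kernel E E) [IsMarkovKernel κ]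
    (x : E) (p : ℕ → E) (n : ℕ) :
    chainMeasure κ x {z | ∀ i ≤ n, z i = p i} =
      (if p 0 = x then 1 else 0) * ∏ i ∈ Finset.range n, κ (p i) {p (i + 1)} := by
  induction n with
  | zero =>
    rw [setOf_forall_le_eq_preimage, chainMeasure,
      ← Measure.map_apply (by fun_prop) (measurableSet_singleton _),
      Kernel.traj_map_frestrictLe_apply, Kernel.partialTraj_self, Kernel.id_apply,
      Measure.dirac_apply' _ (measurableSet_singleton _)]
    simp only [Finset.range_zero, Finset.prod_empty, mul_one, Set.indicator, Set.mem_singleton_iff,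
      Pi.one_apply]
    congr 1
    simp only [funext_iff, eq_iff_iff]
    constructor
    · intro h; exact (h ⟨0, by simp⟩).symm
    · rintro h ⟨i, hi⟩
      have : i = 0 := by simpa using hi
      subst this; exact h.symm
  | succ n ih =>
    have hset : {z : ℕ → E | ∀ i ≤ n + 1, z i = p i} =
        (fun z : ℕ → E => (Preorder.frestrictLe (π := fun _ => E) n z, z (n + 1))) ⁻¹'
          ({fun i : Finset.Iic n => p i} ×ˢ {p (n + 1)}) := by
      ext z
      simp only [Set.mem_ofPred_eq, Set.mem_preimage, Set.mem_prod, Set.mem_singleton_iff,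
        funext_iff, Preorder.frestrictLe_apply, Subtype.forall, Finset.mem_Iic]
      constructor
      · intro h; exact ⟨fun i hi => h i (by omega), h _ le_rfl⟩
      · rintro ⟨h1, h2⟩ i hi
        rcases Nat.lt_or_ge n i with h | h
        · obtain rfl : i = n + 1 := by omega
          exact h2
        · exact h1 i h
    rw [hset, chainMeasure, ← Measure.map_apply (by fun_prop)
      ((measurableSet_singleton _).prod (measurableSet_singleton _)),
      ← Kernel.partialTraj_compProd_eq_map_traj (Nat.zero_le n),
      Measure.compProd_apply_prod (measurableSet_singleton _) (measurableSet_singleton _),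
      lintegral_singleton, ← Kernel.traj_map_frestrictLe_apply,
      Measure.map_apply (by fun_prop) (measurableSet_singleton _), ← setOf_forall_le_eq_preimage]
    change _ * chainMeasure κ x _ = _
    rw [ih, Finset.prod_range_succ]
    simp only [Kernel.comap_apply]
    ring

/-- Decomposition of the law of a chain according to its first step. -/
theorem chainMeasure_eq_sum [Fintype E] (κ : Kernel E E) [IsMarkovKernel κ] (x : E) :
    chainMeasure κ x = ∑ y, κ x {y} • (chainMeasure κ y).map (seqCons x) := by
  classical
  set ν := ∑ y, κ x {y} • (chainMeasure κ y).map (seqCons x) with hν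
  have hcyl : ∀ (p : ℕ → E) (n : ℕ),
      ν {z | ∀ i ≤ n, z i = p i} = chainMeasure κ x {z | ∀ i ≤ n, z i = p i} := by
    intro p n
    have hm : MeasurableSet {z : ℕ → E | ∀ i ≤ n, z i = p i} := by
      rw [setOf_forall_le_eq_preimage]
      exact measurableSet_preimage (by fun_prop) (measurableSet_singleton _)
    rw [chainMeasure_cylinder, hν, Measure.finsetSum_apply]
    simp only [Measure.smul_apply, smul_eq_mul, Measure.map_apply (measurable_seqCons x) hm]
    cases n with
    | zero =>
      have : ∀ y, (chainMeasure κ y) (seqCons x ⁻¹' {z | ∀ i ≤ 0, z i = p i}) =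
          if p 0 = x then 1 else 0 := by
        intro y
        split_ifs with h <;> simp [Set.preimage, h, eq_comm]
      simp only [this, ← Finset.sum_mul, sum_measure_singleton]
      simp
    | succ n =>
      by_cases h : p 0 = x
      · have : ∀ y, (chainMeasure κ y) (seqCons x ⁻¹' {z | ∀ i ≤ n + 1, z i = p i}) =
          (if p 1 = y then 1 else 0) * ∏ i ∈ Finset.range n, κ (p (i + 1)) {p (i + 1 + 1)} := by
          intro y
          rw [← chainMeasure_cylinder κ y (fun i => p (i + 1))]
          congr 1
          ext z
          simp only [Set.mem_preimage, Set.mem_ofPred_eq]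
          constructor
          · intro hz i hi; exact hz (i + 1) (by omega)
          · intro hz i hi
            cases i with
            | zero => exact h.symm
            | succ i => exact hz i (by omega)
        simp only [this, Finset.prod_range_succ', h, if_true, one_mul]
        simp [mul_comm]
      · have : ∀ y, (chainMeasure κ y) (seqCons x ⁻¹' {z | ∀ i ≤ n + 1, z i = p i}) = 0 := by
          intro y
          convert! measure_empty (μ := chainMeasure κ y)
          ext z
          simp only [Set.mem_preimage, Set.mem_ofPred_eq, Set.mem_empty_iff_false, iff_false]
          intro hz; exact h (hz 0 (by omega)).symm
        simp only [this, h]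
        simp
  symm
  -- A measure on sequences is determined by its marginals on initial segments; on a finite space
  -- these are determined by their atoms, that is, by the cylinders computed above.
  refine IsProjectiveLimit.unique (P := fun I => (chainMeasure κ x).map I.restrict) ?_
    (fun _ => rfl)
  rw [isProjectiveLimit_nat_iff]
  · intro n
    refine Measure.ext_of_singleton fun q => ?_
    obtain ⟨p, rfl⟩ : ∃ p : ℕ → E, (fun i : Finset.Iic n => p i) = q :=
      ⟨fun i => if h : i ∈ Finset.Iic n then q ⟨i, h⟩ else x, by ext ⟨i, hi⟩; simp [hi]⟩
    rw [Measure.map_apply (by fun_prop) (measurableSet_singleton _),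
      Measure.map_apply (by fun_prop) (measurableSet_singleton _)]
    have := hcyl p n
    rw [setOf_forall_le_eq_preimage] at this
    exact this
  · intro I J hJ
    rw [Measure.map_map (by fun_prop) (by fun_prop)]
    rfl

theorem chainMeasure_ae_zero [Countable E] (κ : Kernel E E) [IsMarkovKernel κ] (x : E) :
    ∀ᵐ z ∂chainMeasure κ x, z 0 = x := by
  classical
  have h := chainMeasure_cylinder κ x (fun _ => x) 0
  have hm : MeasurableSet {z : ℕ → E | z 0 = x} :=
    (measurableSet_singleton x).preimage (measurable_pi_apply (X := fun _ : ℕ => E) 0)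
  exact (mem_ae_iff_prob_eq_one hm).2 (by simpa using h)

/-- First-step analysis: the Markov property at time 1, from which every recursion in the time n
below is derived. -/
theorem integral_chainMeasure [Fintype E] (κ : Kernel E E) [IsMarkovKernel κ] (x : E)
    (f : (ℕ → E) → ℝ) (hf : Measurable f) (C : ℝ) (hC : ∀ z, |f z| ≤ C) :
    ∫ z, f z ∂chainMeasure κ x =
      ∑ y, (κ x).real {y} * ∫ z, f (seqCons x z) ∂chainMeasure κ y := by
  rw [chainMeasure_eq_sum, integral_finsetSum_measure]
  · refine Finset.sum_congr rfl fun y _ => ?_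
    rw [integral_smul_measure, integral_map (measurable_seqCons x).aemeasurable
      hf.aestronglyMeasurable]
    rfl
  · intro y _
    refine Integrable.smul_measure ?_ (measure_ne_top _ _)
    have : IsProbabilityMeasure ((chainMeasure κ y).map (seqCons x)) :=
      Measure.isProbabilityMeasure_map (measurable_seqCons x).aemeasurable
    exact Integrable.of_bound hf.aestronglyMeasurable C (.of_forall fun z => by simpa using hC z)

end Chain

/-! ### The run of a policy until a fixed time -/

section Run

variable {S A : Type*}

instance [Fintype S] [Fintype A] : Fintype (Obs S A) :=
  Fintype.ofEquiv (Option A × Option S)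
    ⟨fun p => ⟨p.1, p.2⟩, fun x => (x.action, x.state), fun _ => rfl, fun _ => rfl⟩

/-- The value of a function of triples at two consecutive records. -/
def pairVal (F : S → A → S → ℝ) (x y : Obs S A) : ℝ :=
  match x.state, y.action, y.state with
  | some s, some a, some s'' => F s a s''
  | _, _, _ => 0

theorem along_eq_pairVal (F : S → A → S → ℝ) (z : ℕ → Obs S A) (n : ℕ) :
    along F z n = pairVal F (z n) (z (n + 1)) := rfl

theorem exists_pairVal_bound [Fintype S] [Fintype A] (F : S → A → S → ℝ) :
    ∃ C, 0 ≤ C ∧ ∀ x y, |pairVal F x y| ≤ C := by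
  obtain ⟨C, hC⟩ := (Set.finite_range fun p : Obs S A × Obs S A => |pairVal F p.1 p.2|).bddAbove
  have h : ∀ x y, |pairVal F x y| ≤ C := fun x y => hC ⟨(x, y), rfl⟩
  exact ⟨max C 0, le_max_right _ _, fun x y => (h x y).trans (le_max_left _ _)⟩

theorem measurable_along [Fintype S] [Fintype A] (F : S → A → S → ℝ) (n : ℕ) :
    Measurable fun z : ℕ → Obs S A => along F z n := by
  simp only [along_eq_pairVal]
  have : Measurable fun p : Obs S A × Obs S A => pairVal F p.1 p.2 := Measurable.of_discrete
  exact this.comp ((measurable_pi_apply (X := fun _ : ℕ => Obs S A) n).prodMk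
    (measurable_pi_apply (X := fun _ : ℕ => Obs S A) (n + 1)))

variable [Fintype S] [DecidableEq S] [Fintype A] {K : ℕ} {Factor : Fin K → Type*}
  (M : MDP S A K Factor) (π : Policy M)

/-- The record was produced by an ending action. -/
def ObsEnd (x : Obs S A) : Prop := ∃ a, x.action = some a ∧ M.IsEnd a

theorem measurable_cumReward (n : ℕ) :
    Measurable fun z : ℕ → Obs S A => cumReward M z 0 n := by
  unfold cumReward
  refine Finset.measurable_fun_sum _ fun i _ => ?_
  exact (Finset.measurable_fun_prod _ fun m _ => measurable_along M.Γ m).mul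
    (measurable_along M.R i)

/-- A crude bound for each fixed n, used for integrability only. It cannot use Γ ≤ 1, since Γ is
arbitrary at triples of probability zero; the bound linear in n comes later, under the law of the
run. -/
theorem exists_cumReward_bound (n : ℕ) :
    ∃ C, ∀ z : ℕ → Obs S A, |cumReward M z 0 n| ≤ C := by
  obtain ⟨D, hD0, hD⟩ := exists_pairVal_bound M.Γ
  obtain ⟨C, hC0, hC⟩ := exists_pairVal_bound M.R
  refine ⟨∑ i ∈ Finset.Ico 0 n, (∏ m ∈ Finset.Ico 0 i, D) * C, fun z => ?_⟩
  unfold cumReward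
  refine (Finset.abs_sum_le_sum_abs _ _).trans (Finset.sum_le_sum fun i _ => ?_)
  rw [abs_mul, Finset.abs_prod]
  gcongr
  · exact hD _ _
  · exact hC _ _

/-- Horner form: every term after the first carries the first discount as a factor. -/
theorem cumReward_seqCons (x : Obs S A) (z : ℕ → Obs S A) (n : ℕ) :
    cumReward M (seqCons x z) 0 (n + 1) =
      pairVal M.R x (z 0) + pairVal M.Γ x (z 0) * cumReward M z 0 n := by
  have h0 : ∀ F : S → A → S → ℝ, along F (seqCons x z) 0 = pairVal F x (z 0) := fun _ => rfl
  have h1 : ∀ (F : S → A → S → ℝ) (i : ℕ), along F (seqCons x z) (i + 1) = along F z i :=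
    fun _ _ => rfl
  simp only [cumReward, Nat.Ico_zero_eq_range]
  rw [Finset.sum_range_succ', add_comm]
  simp only [Finset.prod_range_succ', h0, h1, Finset.prod_range_zero, one_mul, Finset.mul_sum]
  congr 1
  exact Finset.sum_congr rfl fun i _ => by ring

open Classical in
/-- Up to the factor `(1 - q) ^ (n - 1)`, the conditional probability given the trajectory `z` that
the run stops at time `n`, on the event that the state at this time is `s'`. -/
def stopWeight (q : ℝ) (s' : S) (n : ℕ) (z : ℕ → Obs S A) : ℝ :=
  if (∀ i < n, ¬ ObsEnd M (z i)) ∧ (z n).state = some s' then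
    (if ObsEnd M (z n) then 1 else q) else 0

theorem measurable_stopWeight (q : ℝ) (s' : S) (n : ℕ) : Measurable (stopWeight M q s' n) := by
  classical
  unfold stopWeight
  have h : ∀ i : ℕ, ∀ s : Set (Obs S A), MeasurableSet {z : ℕ → Obs S A | z i ∈ s} :=
    fun i s => (MeasurableSet.of_discrete (s := s)).preimage
      (measurable_pi_apply (X := fun _ : ℕ => Obs S A) i)
  refine Measurable.ite ?_ (Measurable.ite ?_ measurable_const measurable_const) measurable_const
  · refine MeasurableSet.inter ?_ (h n {x | x.state = some s'})
    have : {z : ℕ → Obs S A | ∀ i < n, ¬ ObsEnd M (z i)} =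
        ⋂ i, ⋂ (_ : i < n), {z | z i ∈ {x | ¬ ObsEnd M x}} := by
      ext; simp
    change MeasurableSet {z : ℕ → Obs S A | ∀ i < n, ¬ ObsEnd M (z i)}
    rw [this]
    exact MeasurableSet.iInter fun i => MeasurableSet.iInter fun _ => h i _
  · exact h n {x | ObsEnd M x}

theorem stopWeight_nonneg {q : ℝ} (hq : 0 ≤ q) (s' : S) (n : ℕ) (z : ℕ → Obs S A) :
    0 ≤ stopWeight M q s' n z := by
  unfold stopWeight; split_ifs <;> simp [hq]

theorem stopWeight_le_one {q : ℝ} (hq1 : q ≤ 1) (s' : S) (n : ℕ) (z : ℕ → Obs S A) :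
    stopWeight M q s' n z ≤ 1 := by
  unfold stopWeight; split_ifs <;> simp [hq1]

-- An ending action in the record at time 0 excludes all later stopping times; otherwise only the
-- shifted path matters.
open Classical in
theorem stopWeight_seqCons (q : ℝ) (s' : S) (n : ℕ) (x : Obs S A) (z : ℕ → Obs S A) :
    stopWeight M q s' (n + 1) (seqCons x z) =
      if ObsEnd M x then 0 else stopWeight M q s' n z := by
  unfold stopWeight
  have : (∀ i < n + 1, ¬ ObsEnd M (seqCons x z i)) ↔
      ¬ ObsEnd M x ∧ ∀ i < n, ¬ ObsEnd M (z i) := by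
    constructor
    · intro h; exact ⟨h 0 (by omega), fun i hi => h (i + 1) (by omega)⟩
    · rintro ⟨h0, h⟩ i hi
      cases i with
      | zero => exact h0
      | succ i => exact h i (by omega)
  simp only [this, seqCons_succ]
  by_cases hx : ObsEnd M x
  · simp [hx]
  · simp only [hx, not_false_eq_true, true_and, if_false]
    congr

/-- Law of the run started at the record `x`. -/
abbrev runChain (x : Obs S A) : Measure (ℕ → Obs S A) := chainMeasure (stepKernel M π) x

/-- Expectation of `f` on the event of stopping at `s'` at time `n`, up to the geometric factor. -/
def stopExp (q : ℝ) (s' : S) (n : ℕ) (f : (ℕ → Obs S A) → ℝ) (x : Obs S A) : ℝ :=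
  ∫ z, f z * stopWeight M q s' n z ∂runChain M π x

theorem integrable_mul_stopWeight {q : ℝ} (hq : 0 ≤ q) (hq1 : q ≤ 1) (s' : S)
    (n : ℕ) {f : (ℕ → Obs S A) → ℝ} (hf : Measurable f)
    {C : ℝ} (hC : ∀ z, |f z| ≤ C) (x : Obs S A) :
    Integrable (fun z => f z * stopWeight M q s' n z) (runChain M π x) := by
  refine Integrable.of_bound (hf.mul (measurable_stopWeight M q s' n)).aestronglyMeasurable C
    (.of_forall fun z => ?_)
  rw [Real.norm_eq_abs, abs_mul, abs_of_nonneg (stopWeight_nonneg M hq s' n z)]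
  exact (mul_le_of_le_one_right (abs_nonneg _) (stopWeight_le_one M hq1 s' n z)).trans (hC z)

theorem stopExp_nonneg {q : ℝ} (hq : 0 ≤ q) (s' : S)
    (n : ℕ) {f : (ℕ → Obs S A) → ℝ} (hf : ∀ z, 0 ≤ f z) (x : Obs S A) :
    0 ≤ stopExp M π q s' n f x :=
  integral_nonneg fun z => mul_nonneg (hf z) (stopWeight_nonneg M hq s' n z)

open Classical in
theorem stopExp_succ {q : ℝ} (hq : 0 ≤ q) (hq1 : q ≤ 1) (s' : S)
    (n : ℕ) {f : (ℕ → Obs S A) → ℝ} (hf : Measurable f)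
    {C : ℝ} (hC : ∀ z, |f z| ≤ C) (x : Obs S A) :
    stopExp M π q s' (n + 1) f x = if ObsEnd M x then 0 else
      ∑ y, (stepKernel M π x).real {y} *
        stopExp M π q s' n (fun z => f (seqCons x z)) y := by
  unfold stopExp
  rw [integral_chainMeasure _ _ (fun z => f z * stopWeight M q s' (n + 1) z)
    (hf.mul (measurable_stopWeight M q s' _)) C]
  · simp only [stopWeight_seqCons]
    split_ifs <;> simp
  · intro z
    rw [abs_mul, abs_of_nonneg (stopWeight_nonneg M hq s' _ z)]
    exact (mul_le_of_le_one_right (abs_nonneg _) (stopWeight_le_one M hq1 s' _ z)).trans (hC z)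

/-- Weight of stopping at `s'` at time `n`. -/
def stopMass (q : ℝ) (s' : S) (n : ℕ) (x : Obs S A) : ℝ := stopExp M π q s' n (fun _ => 1) x

/-- Reward until time `n` on the event of stopping at `s'` at time `n`. -/
def stopReward (q : ℝ) (s' : S) (n : ℕ) (x : Obs S A) : ℝ :=
  stopExp M π q s' n (fun z => cumReward M z 0 n) x

/-- Absolute reward until time `n` on the event of stopping at `s'` at time `n`. -/
def stopAbsReward (q : ℝ) (s' : S) (n : ℕ) (x : Obs S A) : ℝ :=
  stopExp M π q s' n (fun z => |cumReward M z 0 n|) x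

open Classical in
theorem stopExp_zero_fun {q : ℝ} (s' : S) (f : (ℕ → Obs S A) → ℝ) (c : ℝ)
    (hf : ∀ z, f z = c) (x : Obs S A) :
    stopExp M π q s' 0 f x =
      if x.state = some s' then c * (if ObsEnd M x then 1 else q) else 0 := by
  unfold stopExp
  have : (fun z => f z * stopWeight M q s' 0 z) =ᵐ[runChain M π x]
      fun _ => if x.state = some s' then c * (if ObsEnd M x then 1 else q) else 0 := by
    filter_upwards [chainMeasure_ae_zero (stepKernel M π) x] with z hz
    simp [stopWeight, hz, hf]
  rw [integral_congr_ae this]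
  simp

open Classical in
theorem stopMass_succ {q : ℝ} (hq : 0 ≤ q) (hq1 : q ≤ 1) (s' : S)
    (n : ℕ) (x : Obs S A) :
    stopMass M π q s' (n + 1) x = if ObsEnd M x then 0 else
      ∑ y, (stepKernel M π x).real {y} * stopMass M π q s' n y :=
  stopExp_succ M π hq hq1 s' n measurable_const (C := 1) (by simp) x

open Classical in
theorem stopReward_succ {q : ℝ} (hq : 0 ≤ q) (hq1 : q ≤ 1) (s' : S)
    (n : ℕ) (x : Obs S A) :
    stopReward M π q s' (n + 1) x = if ObsEnd M x then 0 else
      ∑ y, (stepKernel M π x).real {y} *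
        (pairVal M.R x y * stopMass M π q s' n y + pairVal M.Γ x y * stopReward M π q s' n y) := by
  obtain ⟨C, hC⟩ := exists_cumReward_bound M (n + 1)
  obtain ⟨D, hD⟩ := exists_cumReward_bound M n
  rw [stopReward, stopExp_succ M π hq hq1 s' n (measurable_cumReward M _) hC x]
  congr 1
  refine Finset.sum_congr rfl fun y _ => ?_
  congr 1
  unfold stopMass stopReward stopExp
  rw [← integral_const_mul, ← integral_const_mul, ← integral_add]
  · refine integral_congr_ae ?_
    -- Almost surely the shifted path starts at y, so the first reward and discount are constants
    -- under the integral.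
    filter_upwards [chainMeasure_ae_zero (stepKernel M π) y] with z hz
    rw [cumReward_seqCons, hz]
    ring
  · exact (integrable_mul_stopWeight M π hq hq1 s' n measurable_const (C := 1)
      (by simp) y).const_mul _
  · exact (integrable_mul_stopWeight M π hq hq1 s' n (measurable_cumReward M n) hD y).const_mul _

open Classical in
theorem stopAbsReward_succ_le {q : ℝ} (hq : 0 ≤ q) (hq1 : q ≤ 1) (s' : S)
    (n : ℕ) (x : Obs S A) :
    stopAbsReward M π q s' (n + 1) x ≤ if ObsEnd M x then 0 else
      ∑ y, (stepKernel M π x).real {y} *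
        (|pairVal M.R x y| * stopMass M π q s' n y +
          |pairVal M.Γ x y| * stopAbsReward M π q s' n y) := by
  obtain ⟨C, hC⟩ := exists_cumReward_bound M (n + 1)
  obtain ⟨D, hD⟩ := exists_cumReward_bound M n
  rw [stopAbsReward, stopExp_succ M π hq hq1 s' n (measurable_cumReward M _).abs
    (C := C) (by simpa using hC) x]
  split_ifs with hx
  · exact le_rfl
  refine Finset.sum_le_sum fun y _ => mul_le_mul_of_nonneg_left ?_ measureReal_nonneg
  unfold stopMass stopAbsReward stopExp
  have i1 := (integrable_mul_stopWeight M π hq hq1 s' n measurable_const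
    (f := fun _ => 1) (C := 1) (by simp) y).const_mul |pairVal M.R x y|
  have i2 := (integrable_mul_stopWeight M π hq hq1 s' n (measurable_cumReward M n).abs
    (C := D) (by simpa using hD) y).const_mul |pairVal M.Γ x y|
  rw [← integral_const_mul, ← integral_const_mul, ← integral_add i1 i2]
  refine integral_mono_ae ?_ (i1.add i2) ?_
  · exact integrable_mul_stopWeight M π hq hq1 s' n
      ((measurable_cumReward M _).comp (measurable_seqCons x)).abs (C := C)
      (fun z => by simpa using hC _) y
  · filter_upwards [chainMeasure_ae_zero (stepKernel M π) y] with z hz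
    rw [cumReward_seqCons, hz]
    have h1 := abs_add_le (pairVal M.R x y) (pairVal M.Γ x y * cumReward M z 0 n)
    rw [abs_mul] at h1
    have h2 := mul_le_mul_of_nonneg_right h1 (stopWeight_nonneg M hq s' n z)
    linarith

/-- Averages over the next record. -/
theorem sum_stepKernel (a₀ : Option A) (s : S) (g : Obs S A → ℝ) :
    ∑ y, (stepKernel M π ⟨a₀, some s⟩).real {y} * g y =
      ∑ a ∈ M.avail s, π.prob s a * (∑ s'', M.P s a s'' * g ⟨some a, some s''⟩
        + (1 - ∑ s'', M.P s a s'') * g ⟨some a, none⟩) := by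
  have h1 : ∑ y, (stepKernel M π ⟨a₀, some s⟩).real {y} * g y =
      ∫ y, g y ∂(stepKernel M π ⟨a₀, some s⟩) := by
    rw [integral_fintype Integrable.of_finite]; rfl
  rw [h1]
  change ∫ y, g y ∂(∑ a ∈ M.avail s, ENNReal.ofReal (π.prob s a) •
      (∑ s'', ENNReal.ofReal (M.P s a s'') • Measure.dirac (⟨some a, some s''⟩ : Obs S A)
        + ENNReal.ofReal (1 - ∑ s'', M.P s a s'') • Measure.dirac (⟨some a, none⟩ : Obs S A))) = _
  have hd : ∀ (c : ℝ) (y : Obs S A), IsFiniteMeasure (ENNReal.ofReal c • Measure.dirac y) :=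
    fun c y => Measure.smul_finite _ ENNReal.ofReal_ne_top
  have hs : ∀ a, IsFiniteMeasure
      (∑ s'', ENNReal.ofReal (M.P s a s'') • Measure.dirac (⟨some a, some s''⟩ : Obs S A)) :=
    fun a => inferInstance
  rw [integral_finsetSum_measure fun a _ =>
    (Integrable.of_finite).smul_measure ENNReal.ofReal_ne_top]
  refine Finset.sum_congr rfl fun a ha => ?_
  rw [integral_smul_measure, ENNReal.toReal_ofReal (π.nonneg s a ha), smul_eq_mul,
    integral_add_measure Integrable.of_finite Integrable.of_finite,
    integral_finsetSum_measure fun s'' _ => Integrable.of_finite]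
  simp only [integral_smul_measure, integral_dirac, smul_eq_mul]
  rw [ENNReal.toReal_ofReal (sub_nonneg.2 (M.P_sum_le s a ha))]
  congr 2
  refine Finset.sum_congr rfl fun s'' _ => ?_
  rw [ENNReal.toReal_ofReal (M.P_nonneg s a ha s'')]

end Run

/-! ### Recursions over states -/

section States

variable {S A : Type*} [Fintype S] [DecidableEq S] [Fintype A] {K : ℕ} {Factor : Fin K → Type*}
  (M : MDP S A K Factor) (π : Policy M)

theorem sum_stepKernel_lost (a₀ : Option A) (g : Obs S A → ℝ) :
    ∑ y, (stepKernel M π ⟨a₀, none⟩).real {y} * g y = g ⟨none, none⟩ := by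
  have h1 : ∑ y, (stepKernel M π ⟨a₀, none⟩).real {y} * g y =
      ∫ y, g y ∂(stepKernel M π ⟨a₀, none⟩) := by
    rw [integral_fintype Integrable.of_finite]; rfl
  rw [h1]
  change ∫ y, g y ∂(Measure.dirac (⟨none, none⟩ : Obs S A)) = _
  simp

theorem not_obsEnd_none (s : Option S) : ¬ ObsEnd M (⟨none, s⟩ : Obs S A) := by
  rintro ⟨a, h, _⟩; simp at h

theorem obsEnd_some_iff (a : A) (s : Option S) : ObsEnd M (⟨some a, s⟩ : Obs S A) ↔ M.IsEnd a := by
  simp [ObsEnd]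

/-- A lost run stays lost, so it never shows the state s'. Missing transition mass therefore drops
out of all recursions. -/
theorem stopMass_lost {q : ℝ} (hq : 0 ≤ q) (hq1 : q ≤ 1) (s' : S) (n : ℕ) (a₀ : Option A) :
    stopMass M π q s' n ⟨a₀, none⟩ = 0 := by
  induction n generalizing a₀ with
  | zero => rw [stopMass, stopExp_zero_fun M π s' _ 1 (fun _ => rfl)]; simp
  | succ n ih => rw [stopMass_succ M π hq hq1, sum_stepKernel_lost, ih]; simp

open Classical in
/-- Sum over the transitions by non-ending actions of the policy, weighted by `F` and `f`. -/
def stepOp (F : S → A → S → ℝ) (f : S → ℝ) (s : S) : ℝ :=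
  ∑ a ∈ M.avail s, if M.IsEnd a then 0 else
    π.prob s a * ∑ s'', M.P s a s'' * (F s a s'' * f s'')

/-- Probability of stopping at `s'` at time `n + 1`, for the run started at `s`. -/
def massAt (q : ℝ) (s' : S) (n : ℕ) (s : S) : ℝ :=
  (1 - q) ^ n * stopMass M π q s' (n + 1) ⟨none, some s⟩

/-- Expected reward on the event of stopping at `s'` at time `n + 1`. -/
def rewardAt (q : ℝ) (s' : S) (n : ℕ) (s : S) : ℝ :=
  (1 - q) ^ n * stopReward M π q s' (n + 1) ⟨none, some s⟩

open Classical in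
/-- Expectation of `F (S_0, A_1, S_1)` on the event of stopping at `s'` at time `1`. -/
def firstStep (q : ℝ) (s' : S) (F : S → A → S → ℝ) (s : S) : ℝ :=
  ∑ a ∈ M.avail s, π.prob s a * (M.P s a s' * (F s a s' * if M.IsEnd a then 1 else q))

-- The next step depends on the current state alone; the recorded action matters only through
-- whether it has ended the run. This reduces the recursion over records to one over states. At time
-- 0 it fails, because there the weight itself distinguishes ending actions.
open Classical in
theorem stopMass_succ_some {q : ℝ} (hq : 0 ≤ q) (hq1 : q ≤ 1) (s' : S) (n : ℕ)
    (a : A) (s : S) :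
    stopMass M π q s' (n + 1) ⟨some a, some s⟩ =
      if M.IsEnd a then 0 else stopMass M π q s' (n + 1) ⟨none, some s⟩ := by
  rw [stopMass_succ M π hq hq1, stopMass_succ M π hq hq1]
  simp only [sum_stepKernel, not_obsEnd_none, obsEnd_some_iff, if_false]

open Classical in
theorem stopReward_succ_some {q : ℝ} (hq : 0 ≤ q) (hq1 : q ≤ 1) (s' : S) (n : ℕ)
    (a : A) (s : S) :
    stopReward M π q s' (n + 1) ⟨some a, some s⟩ =
      if M.IsEnd a then 0 else stopReward M π q s' (n + 1) ⟨none, some s⟩ := by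
  rw [stopReward_succ M π hq hq1, stopReward_succ M π hq hq1]
  simp only [sum_stepKernel, not_obsEnd_none, obsEnd_some_iff, if_false]
  rfl

theorem massAt_zero {q : ℝ} (hq : 0 ≤ q) (hq1 : q ≤ 1) (s' s : S) :
    massAt M π q s' 0 s = firstStep M π q s' (fun _ _ _ => 1) s := by
  classical
  simp only [massAt, firstStep, pow_zero, one_mul, stopMass_succ M π hq hq1, sum_stepKernel,
    not_obsEnd_none, if_false, stopMass_lost M π hq hq1, mul_zero, add_zero]
  refine Finset.sum_congr rfl fun a _ => ?_
  congr 1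
  rw [Finset.sum_eq_single s']
  · rw [stopMass, stopExp_zero_fun M π s' _ 1 (fun _ => rfl)]
    simp [obsEnd_some_iff]
  · intro b _ hb
    rw [stopMass, stopExp_zero_fun M π s' _ 1 (fun _ => rfl)]
    simp [hb]
  · simp

theorem massAt_succ {q : ℝ} (hq : 0 ≤ q) (hq1 : q ≤ 1) (s' : S) (n : ℕ) (s : S) :
    massAt M π q s' (n + 1) s =
      (1 - q) * stepOp M π (fun _ _ _ => 1) (massAt M π q s' n) s := by
  classical
  unfold massAt
  rw [stopMass_succ M π hq hq1]
  simp only [sum_stepKernel, not_obsEnd_none, if_false, stopMass_lost M π hq hq1, mul_zero,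
    add_zero, stopMass_succ_some M π hq hq1, stepOp, Finset.mul_sum]
  refine Finset.sum_congr rfl fun a _ => ?_
  split_ifs
  · simp
  · simp only [Finset.mul_sum]
    exact Finset.sum_congr rfl fun b _ => by ring

theorem rewardAt_zero {q : ℝ} (hq : 0 ≤ q) (hq1 : q ≤ 1) (s' s : S) :
    rewardAt M π q s' 0 s = firstStep M π q s' M.R s := by
  classical
  have h0 : ∀ x, stopReward M π q s' 0 x = 0 := fun x => by
    rw [stopReward, stopExp_zero_fun M π s' _ 0 (fun _ => by simp [cumReward])]; simp
  simp only [rewardAt, firstStep, pow_zero, one_mul, stopReward_succ M π hq hq1, sum_stepKernel,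
    not_obsEnd_none, if_false, stopMass_lost M π hq hq1, mul_zero, add_zero, h0]
  refine Finset.sum_congr rfl fun a _ => ?_
  congr 1
  rw [Finset.sum_eq_single s']
  · rw [stopMass, stopExp_zero_fun M π s' _ 1 (fun _ => rfl)]
    simp [obsEnd_some_iff, pairVal]
  · intro b _ hb
    rw [stopMass, stopExp_zero_fun M π s' _ 1 (fun _ => rfl)]
    simp [hb]
  · simp

theorem rewardAt_succ {q : ℝ} (hq : 0 ≤ q) (hq1 : q ≤ 1) (s' : S) (n : ℕ) (s : S) :
    rewardAt M π q s' (n + 1) s = (1 - q) * (stepOp M π M.R (massAt M π q s' n) s +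
      stepOp M π M.Γ (rewardAt M π q s' n) s) := by
  classical
  unfold massAt rewardAt
  rw [stopReward_succ M π hq hq1]
  simp only [sum_stepKernel, not_obsEnd_none, if_false, stopMass_lost M π hq hq1, mul_zero,
    stopMass_succ_some M π hq hq1, stopReward_succ_some M π hq hq1, stepOp, Finset.mul_sum,
    pairVal, zero_mul, add_zero, ← Finset.sum_add_distrib]
  refine Finset.sum_congr rfl fun a _ => ?_
  split_ifs
  · simp
  · simp only [Finset.mul_sum, ← Finset.sum_add_distrib]
    exact Finset.sum_congr rfl fun b _ => by ring

theorem massAt_nonneg {q : ℝ} (hq : 0 ≤ q) (hq1 : q ≤ 1) (s' : S) (n : ℕ) (s : S) :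
    0 ≤ massAt M π q s' n s :=
  mul_nonneg (pow_nonneg (sub_nonneg.2 hq1) _)
    (stopExp_nonneg M π hq s' _ (fun _ => zero_le_one) _)

/-- Induction on n: one step adds at most C, and discounting does not increase the absolute value of
the rest. -/
theorem stopAbsReward_le {q : ℝ} (hq : 0 ≤ q) (hq1 : q ≤ 1) (s' : S) {C : ℝ}
    (hC : ∀ x y, |pairVal M.R x y| ≤ C) (n : ℕ) (x : Obs S A) :
    stopAbsReward M π q s' n x ≤ C * n * stopMass M π q s' n x := by
  classical
  have hU : ∀ n x, 0 ≤ stopMass M π q s' n x := fun n x =>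
    stopExp_nonneg M π hq s' _ (fun _ => zero_le_one) _
  have hG : ∀ n x, 0 ≤ stopAbsReward M π q s' n x := fun n x =>
    stopExp_nonneg M π hq s' _ (fun _ => abs_nonneg _) _
  induction n generalizing x with
  | zero =>
    rw [stopAbsReward, stopExp_zero_fun M π s' _ 0 (fun _ => by simp [cumReward])]; simp
  | succ n ih =>
    refine (stopAbsReward_succ_le M π hq hq1 s' n x).trans ?_
    rw [stopMass_succ M π hq hq1]
    split_ifs
    · simp
    -- Here c is a transition probability. The discount bound is asked for only after multiplication
    -- by c, as Γ ≤ 1 is known only where c > 0.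
    have key : ∀ y c, 0 ≤ c → c * |pairVal M.Γ x y| ≤ c →
        c * (|pairVal M.R x y| * stopMass M π q s' n y +
          |pairVal M.Γ x y| * stopAbsReward M π q s' n y) ≤
        c * (C * (n + 1) * stopMass M π q s' n y) := by
      intro y c hc hΓ
      have h1 := mul_le_mul_of_nonneg_left
        (mul_le_mul_of_nonneg_right (hC x y) (hU n y)) hc
      have h2 := mul_le_mul_of_nonneg_right hΓ (hG n y)
      have h3 := mul_le_mul_of_nonneg_left (ih y) hc
      linarith
    obtain ⟨a₀, st⟩ := x
    cases st with
    | none =>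
      rw [Finset.mul_sum]
      refine Finset.sum_le_sum fun y _ => (key y _ measureReal_nonneg ?_).trans (le_of_eq ?_)
      · simp [pairVal]
      · push_cast; ring
    | some s =>
      rw [sum_stepKernel, sum_stepKernel, Finset.mul_sum]
      refine Finset.sum_le_sum fun a ha => ?_
      rw [mul_left_comm]
      refine mul_le_mul_of_nonneg_left ?_ (π.nonneg s a ha)
      rw [mul_add (C * _), Finset.mul_sum]
      refine add_le_add (Finset.sum_le_sum fun s'' _ => ?_) ?_
      · refine (key _ _ (M.P_nonneg s a ha s'') ?_).trans (le_of_eq (by push_cast; ring))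
        rcases (M.P_nonneg s a ha s'').eq_or_lt with h | h
        · simp [← h]
        · have h1 := M.Γ_nonneg s a ha s'' h
          have h2 := M.Γ_le_one s a ha s'' h
          refine mul_le_of_le_one_right h.le ?_
          change |M.Γ s a s''| ≤ 1
          rwa [abs_of_nonneg h1]
      · refine (key _ _ (sub_nonneg.2 (M.P_sum_le s a ha)) ?_).trans
          (le_of_eq (by push_cast; ring))
        simpa [pairVal] using M.P_sum_le s a ha

end States

/-! ### The geometric time -/

section Geometric

variable {q : ℝ}

theorem geoMeasure_apply (hq : q ≠ 0) (B : Set ℕ∞) :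
    geoMeasure q B = ∑' n : ℕ, ENNReal.ofReal ((1 - q) ^ n * q) *
      B.indicator 1 ((n + 1 : ℕ) : ℕ∞) := by
  rw [geoMeasure, if_neg hq, Measure.sum_apply _ MeasurableSet.of_discrete]
  simp

theorem isProbabilityMeasure_geoMeasure (hq : 0 ≤ q) (hq1 : q ≤ 1) :
    IsProbabilityMeasure (geoMeasure q) := by
  constructor
  by_cases h : q = 0
  · simp [geoMeasure, h]
  · rw [geoMeasure_apply h]
    have h1 : HasSum (fun n : ℕ => (1 - q) ^ n * q) 1 := by
      have := (hasSum_geometric_of_lt_one (sub_nonneg.2 hq1)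
        (by linarith [lt_of_le_of_ne hq (Ne.symm h)])).mul_right q
      simpa [h] using this
    simp only [Set.indicator_univ, Pi.one_apply, mul_one]
    rw [← ENNReal.ofReal_tsum_of_nonneg
      (fun n => mul_nonneg (pow_nonneg (sub_nonneg.2 hq1) _) hq) h1.summable, h1.tsum_eq]
    simp

theorem geoMeasure_real_singleton (hq : 0 ≤ q) (hq1 : q ≤ 1) (n : ℕ) :
    (geoMeasure q).real {((n + 1 : ℕ) : ℕ∞)} = (1 - q) ^ n * q := by
  by_cases h : q = 0
  · have : ((n + 1 : ℕ) : ℕ∞) ≠ ⊤ := ENat.natCast_ne_top _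
    subst h
    simp [geoMeasure, measureReal_def, this.symm, -Nat.cast_add]
  · rw [measureReal_def, geoMeasure_apply h, tsum_eq_single n]
    · simp [ENNReal.toReal_ofReal (mul_nonneg (pow_nonneg (sub_nonneg.2 hq1) n) hq)]
    · intro m hm
      have : ((m + 1 : ℕ) : ℕ∞) ≠ ((n + 1 : ℕ) : ℕ∞) := by
        intro h'; exact hm (by have := Nat.cast_injective h'; omega)
      simp [Set.indicator, this, -Nat.cast_add]

theorem geoMeasure_zero (q : ℝ) : geoMeasure q {0} = 0 := by
  by_cases h : q = 0
  · simp [geoMeasure, h]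
  · rw [geoMeasure_apply h]
    simp [Set.indicator]

/-- Splitting off one atom at a time avoids summing a geometric tail and also covers q = 0, where
all the mass sits at ∞. -/
theorem geoMeasure_real_Ici (hq : 0 ≤ q) (hq1 : q ≤ 1) (n : ℕ) :
    (geoMeasure q).real (Set.Ici ((n + 1 : ℕ) : ℕ∞)) = (1 - q) ^ n := by
  have := isProbabilityMeasure_geoMeasure hq hq1
  have hsplit : ∀ k : ℕ, Set.Ici ((k : ℕ) : ℕ∞) = {(k : ℕ∞)} ∪ Set.Ici ((k + 1 : ℕ) : ℕ∞) := by
    intro k; ext g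
    induction g with
    | top => simp
    | coe g =>
      simp only [Set.mem_Ici, Set.mem_union, Set.mem_singleton_iff, Nat.cast_le, Nat.cast_inj]
      omega
  have hd : ∀ k : ℕ, Disjoint {(k : ℕ∞)} (Set.Ici ((k + 1 : ℕ) : ℕ∞)) := by
    intro k
    rw [Set.disjoint_singleton_left, Set.mem_Ici, Nat.cast_le]
    omega
  have hrec : ∀ k : ℕ, (geoMeasure q).real (Set.Ici ((k : ℕ) : ℕ∞)) =
      (geoMeasure q).real {(k : ℕ∞)} + (geoMeasure q).real (Set.Ici ((k + 1 : ℕ) : ℕ∞)) := by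
    intro k
    rw [hsplit k, measureReal_union (hd k) MeasurableSet.of_discrete]
  induction n with
  | zero =>
    have h := hrec 0
    have h0 : Set.Ici (((0 : ℕ) : ℕ∞)) = Set.univ := by ext; simp
    have h1 : (geoMeasure q).real {((0 : ℕ) : ℕ∞)} = 0 := by
      rw [measureReal_def, Nat.cast_zero, geoMeasure_zero]; simp
    rw [h0, h1, probReal_univ] at h
    simpa using h.symm
  | succ n ih =>
    have h := hrec (n + 1)
    rw [ih, geoMeasure_real_singleton hq hq1] at h
    rw [pow_succ]; linarith

end Geometric

/-! ### Decomposition according to the stopping time -/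

section StopTime

variable {S A : Type*} [Fintype S] [DecidableEq S] [Fintype A] {K : ℕ} {Factor : Fin K → Type*}
  (M : MDP S A K Factor) (π : Policy M)

theorem natCast_le_firstEnd_iff (n : ℕ) (z : ℕ → Obs S A) :
    (n : ℕ∞) ≤ firstEnd M z ↔ ∀ i, ObsEnd M (z i) → n ≤ i := by
  simp only [firstEnd, le_iInf_iff, Nat.cast_le]
  rfl

theorem measurableSet_natCast_le_firstEnd (n : ℕ) :
    MeasurableSet {z : ℕ → Obs S A | (n : ℕ∞) ≤ firstEnd M z} := by
  have : {z : ℕ → Obs S A | (n : ℕ∞) ≤ firstEnd M z} =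
      ⋂ i, (fun z : ℕ → Obs S A => z i) ⁻¹' {x | ObsEnd M x → n ≤ i} := by
    ext z
    simp [natCast_le_firstEnd_iff]
  rw [this]
  exact MeasurableSet.iInter fun i => MeasurableSet.of_discrete.preimage
    (measurable_pi_apply (X := fun _ : ℕ => Obs S A) i)

theorem measurable_firstEnd : Measurable (firstEnd M) := by
  refine measurable_to_countable' fun c => ?_
  induction c with
  | top =>
    have : firstEnd M ⁻¹' {⊤} = ⋂ n : ℕ, {z : ℕ → Obs S A | (n : ℕ∞) ≤ firstEnd M z} := by
      ext z
      simp only [Set.mem_preimage, Set.mem_singleton_iff, Set.mem_iInter, Set.mem_ofPred_eq]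
      rw [← top_le_iff, ← ENat.forall_natCast_le_iff_le]
      simp
    rw [this]
    exact MeasurableSet.iInter fun n => measurableSet_natCast_le_firstEnd M n
  | coe n =>
    have : firstEnd M ⁻¹' {(n : ℕ∞)} = {z : ℕ → Obs S A | (n : ℕ∞) ≤ firstEnd M z} \
        {z | ((n + 1 : ℕ) : ℕ∞) ≤ firstEnd M z} := by
      ext z
      simp only [Set.mem_preimage, Set.mem_singleton_iff, Set.mem_sdiff, Set.mem_ofPred_eq]
      generalize firstEnd M z = e
      induction e with
      | top => simp
      | coe e => simp only [Nat.cast_inj, Nat.cast_le]; omega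
    rw [this]
    exact (measurableSet_natCast_le_firstEnd M n).diff (measurableSet_natCast_le_firstEnd M _)

theorem measurable_stopTime : Measurable (stopTime M) := by
  have : Measurable fun p : ℕ∞ × ℕ∞ => min p.1 p.2 := Measurable.of_discrete
  exact this.comp (measurable_snd.prodMk ((measurable_firstEnd M).comp measurable_fst))

/-- The event `{τ = n, S_n = s'}`. -/
def stopSlice (s' : S) (n : ℕ) : Set ((ℕ → Obs S A) × ℕ∞) :=
  {ω | stopTime M ω = n ∧ (ω.1 n).state = some s'}

theorem measurableSet_stopSlice (s' : S) (n : ℕ) : MeasurableSet (stopSlice M s' n) := by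
  refine MeasurableSet.inter
    ((measurableSet_singleton (n : ℕ∞)).preimage (measurable_stopTime M)) ?_
  exact (MeasurableSet.of_discrete (s := {x : Obs S A | x.state = some s'})).preimage
    ((measurable_pi_apply (X := fun _ : ℕ => Obs S A) n).comp measurable_fst)

theorem stopsAt_eq_iUnion (s' : S) : stopsAt M s' = ⋃ n, stopSlice M s' n := by
  ext ω; simp [stopsAt, stopSlice]

theorem pairwise_disjoint_stopSlice (s' : S) :
    Pairwise (Function.onFun Disjoint (stopSlice M s')) := by
  intro m n hmn
  rw [Function.onFun, Set.disjoint_left]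
  rintro ω ⟨h1, _⟩ ⟨h2, _⟩
  exact hmn (Nat.cast_injective (h1.symm.trans h2))

theorem trajMeasure_eq (s : S) : trajMeasure M π s = runChain M π ⟨none, some s⟩ := rfl

-- Given the path, if the first ending action occurs at time n + 1 then stopping there means τ₀ ≥ n
-- + 1; if it occurs later or never, it means τ₀ = n + 1; if it occurs earlier, it is impossible.
open Classical in
theorem geoMeasure_real_stopTime_eq {q : ℝ} (hq : 0 ≤ q) (hq1 : q ≤ 1) (z : ℕ → Obs S A)
    (n : ℕ) :
    (geoMeasure q).real {g | stopTime M (z, g) = ((n + 1 : ℕ) : ℕ∞)} =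
      (1 - q) ^ n * if ∀ i < n + 1, ¬ ObsEnd M (z i) then
        (if ObsEnd M (z (n + 1)) then 1 else q) else 0 := by
  unfold stopTime
  split_ifs with h1 h2
  · have hle : ((n + 1 : ℕ) : ℕ∞) ≤ firstEnd M z :=
      (natCast_le_firstEnd_iff M _ z).2 fun i hi => not_lt.1 fun hlt => h1 i hlt hi
    have hge : ¬ ((n + 1 + 1 : ℕ) : ℕ∞) ≤ firstEnd M z := by
      rw [natCast_le_firstEnd_iff]
      intro h; have := h _ h2; omega
    have heq : firstEnd M z = ((n + 1 : ℕ) : ℕ∞) := by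
      revert hle hge
      generalize firstEnd M z = e
      induction e with
      | top => simp
      | coe e => simp only [Nat.cast_inj, Nat.cast_le]; omega
    have : {g : ℕ∞ | min g (firstEnd M z) = ((n + 1 : ℕ) : ℕ∞)} =
        Set.Ici ((n + 1 : ℕ) : ℕ∞) := by
      ext g; rw [heq]; simp [-Nat.cast_add]
    change (geoMeasure q).real {g : ℕ∞ | min g (firstEnd M z) = ((n + 1 : ℕ) : ℕ∞)} = _
    rw [this, geoMeasure_real_Ici hq hq1, mul_one]
  · have hle : ((n + 1 + 1 : ℕ) : ℕ∞) ≤ firstEnd M z :=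
      (natCast_le_firstEnd_iff M _ z).2 fun i hi => by
        by_contra hlt
        rcases Nat.lt_or_ge i (n + 1) with h | h
        · exact h1 i h hi
        · obtain rfl : i = n + 1 := by omega
          exact h2 hi
    have : {g : ℕ∞ | min g (firstEnd M z) = ((n + 1 : ℕ) : ℕ∞)} = {((n + 1 : ℕ) : ℕ∞)} := by
      ext g
      simp only [Set.mem_ofPred_eq, Set.mem_singleton_iff]
      have hlt : ((n + 1 : ℕ) : ℕ∞) < firstEnd M z :=
        lt_of_lt_of_le (Nat.cast_lt.2 (Nat.lt_succ_self _)) hle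
      constructor
      · intro h
        rcases min_choice g (firstEnd M z) with h' | h'
        · rw [← h', h]
        · rw [h'] at h; exact absurd h hlt.ne'
      · rintro rfl; exact min_eq_left hlt.le
    change (geoMeasure q).real {g : ℕ∞ | min g (firstEnd M z) = ((n + 1 : ℕ) : ℕ∞)} = _
    rw [this, geoMeasure_real_singleton hq hq1]
  · push Not at h1
    obtain ⟨i, hi, hz⟩ := h1
    have : {g : ℕ∞ | min g (firstEnd M z) = ((n + 1 : ℕ) : ℕ∞)} = ∅ := by
      ext g
      simp only [Set.mem_ofPred_eq, Set.mem_empty_iff_false, iff_false]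
      intro h
      have := (natCast_le_firstEnd_iff M _ z).1 (h ▸ min_le_right g (firstEnd M z)) i hz
      omega
    change (geoMeasure q).real {g : ℕ∞ | min g (firstEnd M z) = ((n + 1 : ℕ) : ℕ∞)} = _
    rw [this]; simp

theorem stopProb_nonneg (t : ℝ≥0∞) : 0 ≤ stopProb t := ENNReal.toReal_nonneg

theorem stopProb_le_one {t : ℝ≥0∞} (ht : 1 ≤ t) : stopProb t ≤ 1 := by
  unfold stopProb
  exact ENNReal.toReal_le_of_le_ofReal zero_le_one (by simpa using ht)

theorem isProbabilityMeasure_runMeasure {t : ℝ≥0∞} (ht : 1 ≤ t) (s : S) :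
    IsProbabilityMeasure (runMeasure M π t s) := by
  have := isProbabilityMeasure_geoMeasure (stopProb_nonneg t) (stopProb_le_one ht)
  rw [runMeasure, trajMeasure_eq]
  infer_instance

/-- Fubini: for a fixed path, integrating out the independent time τ₀ leaves the stopping weight and
the factor (1 - q)^n. -/
theorem setIntegral_stopSlice_succ {t : ℝ≥0∞} (ht : 1 ≤ t) (s s' : S) (n : ℕ)
    {f : (ℕ → Obs S A) → ℝ} (hf : Measurable f) {C : ℝ} (hC : ∀ z, |f z| ≤ C) :
    ∫ ω in stopSlice M s' (n + 1), f ω.1 ∂runMeasure M π t s =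
      (1 - stopProb t) ^ n * stopExp M π (stopProb t) s' (n + 1) f ⟨none, some s⟩ := by
  classical
  have hq := stopProb_nonneg t
  have hq1 := stopProb_le_one ht
  have := isProbabilityMeasure_geoMeasure hq hq1
  have := isProbabilityMeasure_runMeasure M π ht s
  have hm := measurableSet_stopSlice M s' (n + 1)
  rw [← integral_indicator hm]
  have hint : Integrable ((stopSlice M s' (n + 1)).indicator fun ω => f ω.1)
      (runMeasure M π t s) :=
    (Integrable.of_bound (hf.comp measurable_fst).aestronglyMeasurable C
      (.of_forall fun ω => hC ω.1)).indicator hm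
  rw [runMeasure, trajMeasure_eq] at hint ⊢
  rw [integral_prod _ hint, stopExp, ← integral_const_mul]
  congr 1
  ext z
  have h1 : (fun g => (stopSlice M s' (n + 1)).indicator (fun ω => f ω.1) (z, g)) =
      {g | stopTime M (z, g) = ((n + 1 : ℕ) : ℕ∞)}.indicator
        fun _ => if (z (n + 1)).state = some s' then f z else 0 := by
    ext g
    simp only [Set.indicator, stopSlice, Set.mem_ofPred_eq]
    by_cases h : stopTime M (z, g) = ((n + 1 : ℕ) : ℕ∞) <;> simp [h, -Nat.cast_add]
  rw [h1, integral_indicator MeasurableSet.of_discrete, setIntegral_const,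
    geoMeasure_real_stopTime_eq M hq hq1, stopWeight, smul_eq_mul]
  split_ifs <;> simp_all [mul_assoc, mul_comm (f z)]

/-- Almost surely τ₀ ≥ 1 and the initial record carries no action. Hence all series over stopping
times start at time 1, which explains the shift by one. -/
theorem runMeasure_stopSlice_zero {t : ℝ≥0∞} (ht : 1 ≤ t) (s s' : S) :
    runMeasure M π t s (stopSlice M s' 0) = 0 := by
  have := isProbabilityMeasure_geoMeasure (stopProb_nonneg t) (stopProb_le_one ht)
  have hsub : stopSlice M s' 0 ⊆
      {z : ℕ → Obs S A | z 0 = ⟨none, some s⟩}ᶜ ×ˢ Set.univ ∪ Set.univ ×ˢ {(0 : ℕ∞)} := by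
    rintro ⟨z, g⟩ ⟨h, _⟩
    by_cases hg : g = 0
    · right; simp [hg]
    · left
      refine ⟨fun hz => ?_, trivial⟩
      have hz' : z 0 = ⟨none, some s⟩ := hz
      have h1 : ((1 : ℕ) : ℕ∞) ≤ firstEnd M z := by
        rw [natCast_le_firstEnd_iff]
        intro i hi
        by_contra hlt
        obtain rfl : i = 0 := by omega
        rw [hz'] at hi
        exact not_obsEnd_none M _ hi
      have h2 : ((1 : ℕ) : ℕ∞) ≤ g := by
        rw [Nat.cast_one]; exact Order.one_le_iff_ne_zero.2 hg
      have h3 : ((1 : ℕ) : ℕ∞) ≤ stopTime M (z, g) := le_min h2 h1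
      rw [h] at h3
      simp at h3
  refine measure_mono_null hsub (measure_union_null ?_ ?_)
  · rw [runMeasure, Measure.prod_prod, trajMeasure_eq]
    have : runChain M π ⟨none, some s⟩ {z : ℕ → Obs S A | z 0 = ⟨none, some s⟩}ᶜ = 0 :=
      chainMeasure_ae_zero (stepKernel M π) _
    rw [this, zero_mul]
  · rw [runMeasure, Measure.prod_prod, geoMeasure_zero, mul_zero]

theorem hasSum_massAt {t : ℝ≥0∞} (ht : 1 ≤ t) (s s' : S) :
    HasSum (fun n => massAt M π (stopProb t) s' n s) (compP M π t s s') := by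
  have := isProbabilityMeasure_runMeasure M π ht s
  have h := hasSum_integral_iUnion (μ := runMeasure M π t s) (f := fun _ => (1 : ℝ))
    (measurableSet_stopSlice M s') (pairwise_disjoint_stopSlice M s')
    (integrable_const _).integrableOn
  rw [← stopsAt_eq_iUnion, ← hasSum_nat_add_iff' 1] at h
  have e : ∀ n, ∫ _ in stopSlice M s' (n + 1), (1 : ℝ) ∂runMeasure M π t s =
      massAt M π (stopProb t) s' n s := fun n =>
    setIntegral_stopSlice_succ M π ht s s' n (f := fun _ => 1) measurable_const (C := 1) (by simp)
  simp only [e] at h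
  simpa [measureReal_def, runMeasure_stopSlice_zero M π ht, compP] using h

theorem stoppedReward_of_mem_stopSlice {s' : S} {n : ℕ} {ω : (ℕ → Obs S A) × ℕ∞}
    (h : ω ∈ stopSlice M s' n) : stoppedReward M ω = cumReward M ω.1 0 n := by
  rw [stoppedReward, h.1]; rfl

theorem setIntegral_stoppedReward {t : ℝ≥0∞} (ht : 1 ≤ t) (s s' : S) (n : ℕ) :
    ∫ ω in stopSlice M s' (n + 1), stoppedReward M ω ∂runMeasure M π t s =
      rewardAt M π (stopProb t) s' n s := by
  obtain ⟨C, hC⟩ := exists_cumReward_bound M (n + 1)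
  rw [setIntegral_congr_fun (measurableSet_stopSlice M s' _)
    (fun ω hω => stoppedReward_of_mem_stopSlice M hω),
    setIntegral_stopSlice_succ M π ht s s' n (measurable_cumReward M _) hC]
  rfl

theorem integrableOn_stoppedReward_stopSlice {t : ℝ≥0∞} (ht : 1 ≤ t) (s s' : S) (n : ℕ) :
    IntegrableOn (stoppedReward M) (stopSlice M s' n) (runMeasure M π t s) := by
  have := isProbabilityMeasure_runMeasure M π ht s
  obtain ⟨C, hC⟩ := exists_cumReward_bound M n
  refine IntegrableOn.congr_fun (f := fun ω => cumReward M ω.1 0 n) ?_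
    (fun ω hω => (stoppedReward_of_mem_stopSlice M hω).symm) (measurableSet_stopSlice M s' n)
  exact (Integrable.of_bound ((measurable_cumReward M n).comp measurable_fst).aestronglyMeasurable C
    (.of_forall fun ω => hC ω.1)).integrableOn

/-- On the slice τ = n + 1 the absolute reward integrates to at most C (n + 1) times the mass of the
slice, so the slices sum to a finite total. -/
theorem integrableOn_stoppedReward {t : ℝ≥0∞} (ht : 1 ≤ t) (s s' : S)
    (hs : Summable fun n : ℕ => ((n : ℝ) + 1) * massAt M π (stopProb t) s' n s) :
    IntegrableOn (stoppedReward M) (stopsAt M s') (runMeasure M π t s) := by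
  have hq := stopProb_nonneg t
  have hq1 := stopProb_le_one ht
  rw [stopsAt_eq_iUnion]
  refine integrableOn_iUnion_of_summable_integral_norm
    (integrableOn_stoppedReward_stopSlice M π ht s s') ?_
  rw [← summable_nat_add_iff 1]
  obtain ⟨C, hC0, hC⟩ := exists_pairVal_bound M.R
  refine Summable.of_nonneg_of_le (fun n => integral_nonneg fun _ => norm_nonneg _) (fun n => ?_)
    (hs.mul_left C)
  obtain ⟨D, hD⟩ := exists_cumReward_bound M (n + 1)
  rw [setIntegral_congr_fun (g := fun ω => |cumReward M ω.1 0 (n + 1)|)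
    (measurableSet_stopSlice M s' _)
    (fun ω hω => by simp only [stoppedReward_of_mem_stopSlice M hω, Real.norm_eq_abs]),
    setIntegral_stopSlice_succ M π ht s s' n (measurable_cumReward M _).abs (C := D)
      (by simpa using hD)]
  have := mul_le_mul_of_nonneg_left (stopAbsReward_le M π hq hq1 s' hC (n + 1) ⟨none, some s⟩)
    (pow_nonneg (sub_nonneg.2 hq1) n)
  refine this.trans (le_of_eq ?_)
  unfold massAt
  push_cast; ring

theorem hasSum_rewardAt {t : ℝ≥0∞} (ht : 1 ≤ t) (s s' : S)
    (hs : Summable fun n : ℕ => ((n : ℝ) + 1) * massAt M π (stopProb t) s' n s) :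
    HasSum (fun n => rewardAt M π (stopProb t) s' n s)
      (∫ ω in stopsAt M s', stoppedReward M ω ∂runMeasure M π t s) := by
  have hi := integrableOn_stoppedReward M π ht s s' hs
  rw [stopsAt_eq_iUnion] at hi
  have h := hasSum_integral_iUnion (measurableSet_stopSlice M s')
    (pairwise_disjoint_stopSlice M s') hi
  rw [← stopsAt_eq_iUnion, ← hasSum_nat_add_iff' 1] at h
  simp only [setIntegral_stoppedReward M π ht] at h
  simpa [setIntegral_measure_zero _ (runMeasure_stopSlice_zero M π ht s s')] using h

end StopTime

/-! ### Summable orbits of monotone linear maps -/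

section Orbit

variable {S : Type*} {u : ℕ → S → ℝ} {U : S → ℝ}

theorem tendsto_tail_of_hasSum (hU : HasSum u U) (s : S) :
    Filter.Tendsto (fun n => (U - ∑ i ∈ Finset.range n, u i) s) Filter.atTop (nhds 0) := by
  have h := (hU.tendsto_sum_nat.const_sub U)
  rw [sub_self] at h
  exact (tendsto_pi_nhds.1 h s)

variable [Fintype S] {L : (S → ℝ) →ₗ[ℝ] (S → ℝ)}

/-- In finite dimension L is continuous and passes through the sum, shifting the orbit by one. The
case n = 0 is the fixed-point equation of U. -/
theorem map_tail_of_hasSum (hu : ∀ n, u (n + 1) = L (u n)) (hU : HasSum u U) (n : ℕ) :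
    L (U - ∑ i ∈ Finset.range n, u i) = U - ∑ i ∈ Finset.range (n + 1), u i := by
  have h1 := (hasSum_nat_add_iff' n).2 hU
  have h2 := (hasSum_nat_add_iff' (n + 1)).2 hU
  have h3 := (LinearMap.toContinuousLinearMap L).hasSum h1
  refine h3.unique ?_
  convert! h2 using 2
  rename_i k
  exact (hu (k + n)).symm

/-- A summable orbit of a monotone linear map is summable with linear weights. -/
theorem summable_mul_of_hasSum (hL : ∀ f g, f ≤ g → L f ≤ L g) (hu0 : ∀ n, 0 ≤ u n)
    (hu : ∀ n, u (n + 1) = L (u n)) (hU : HasSum u U) (s : S) :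
    Summable fun n : ℕ => ((n : ℝ) + 1) * u n s := by
  set T : ℕ → S → ℝ := fun n => U - ∑ i ∈ Finset.range n, u i with hT
  have hTL : ∀ n, T (n + 1) = L (T n) := fun n => (map_tail_of_hasSum hu hU n).symm
  have hTu : ∀ n, u n = T n - T (n + 1) := fun n => by
    simp [hT, Finset.sum_range_succ]
  have hT0 : ∀ n, 0 ≤ T n := fun n =>
    ((hasSum_nat_add_iff' n).2 hU).nonneg fun k => hu0 _
  have hanti : Antitone T := antitone_nat_of_succ_le fun n => by
    have := hu0 n; rw [hTu n] at this; exact sub_nonneg.1 this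
  -- Where T_0 vanishes, so do all later tails by monotonicity; elsewhere the tails tend to 0 < T_0
  -- / 2. Finiteness of S makes k uniform.
  obtain ⟨k, hk⟩ : ∃ k, T k ≤ (1 / 2 : ℝ) • T 0 := by
    have hev : ∀ s, ∀ᶠ k in Filter.atTop, T k s ≤ (1 / 2 : ℝ) * T 0 s := by
      intro s
      rcases (hT0 0 s).eq_or_lt with h | h
      · refine Filter.Eventually.of_forall fun k => ?_
        have h' : T 0 s = 0 := h.symm
        have := hanti (Nat.zero_le k) s
        rw [h'] at this ⊢
        simpa using this
      · have h' : 0 < T 0 s := h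
        exact (tendsto_tail_of_hasSum hU s).eventually (ge_mem_nhds (by positivity)) |>.mono
          fun _ h => h
    obtain ⟨k, hk⟩ := (Filter.eventually_all.2 hev).exists
    exact ⟨k, fun s => hk s⟩
  have hhalf : ∀ n, T (n + k) ≤ (1 / 2 : ℝ) • T n := by
    intro n
    induction n with
    | zero => simpa using hk
    | succ n ih =>
      rw [show n + 1 + k = n + k + 1 by omega, hTL, hTL, ← map_smul]
      exact hL _ _ ih
  -- With Σ the sum of the first m tails, halving after k steps gives Σ ≤ ∑_{i<k} T_i + Σ / 2.
  have hbd : ∀ m, ∑ i ∈ Finset.range m, T i s ≤ 2 * ∑ i ∈ Finset.range k, T i s := by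
    intro m
    have h1 : ∑ i ∈ Finset.range m, T i s ≤ ∑ i ∈ Finset.range (k + m), T i s :=
      Finset.sum_le_sum_of_subset_of_nonneg (by simp) fun i _ _ => hT0 i s
    have h2 : ∑ i ∈ Finset.range m, T (k + i) s ≤ 1 / 2 * ∑ i ∈ Finset.range m, T i s := by
      rw [Finset.mul_sum]
      exact Finset.sum_le_sum fun i _ => by rw [add_comm]; exact hhalf i s
    rw [Finset.sum_range_add] at h1
    linarith
  -- Abel summation for u_n = T_n - T_{n+1}; the boundary term has a favourable sign.
  have habel : ∀ m : ℕ, ∑ n ∈ Finset.range m, ((n : ℝ) + 1) * u n s =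
      ∑ n ∈ Finset.range m, T n s - m * T m s := by
    intro m
    induction m with
    | zero => simp
    | succ m ih =>
      rw [Finset.sum_range_succ, Finset.sum_range_succ, ih, hTu m, Pi.sub_apply]
      push_cast; ring
  refine summable_of_sum_range_le (c := 2 * ∑ i ∈ Finset.range k, T i s)
    (fun n => mul_nonneg (by positivity) (hu0 n s)) fun m => ?_
  rw [habel]
  have := mul_nonneg (Nat.cast_nonneg (α := ℝ) m) (hT0 m s)
  linarith [hbd m]

/-- A vector dominated by the sum of a summable orbit and by its own image vanishes. -/
theorem eq_zero_of_abs_le (hL : ∀ f g, f ≤ g → L f ≤ L g) (hu : ∀ n, u (n + 1) = L (u n))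
    (hU : HasSum u U) {D : S → ℝ} (hD : |D| ≤ L |D|) {C : ℝ} (hC : |D| ≤ C • U) : D = 0 := by
  have h : ∀ n, |D| ≤ C • (U - ∑ i ∈ Finset.range n, u i) := by
    intro n
    induction n with
    | zero => simpa using hC
    | succ n ih =>
      rw [← map_tail_of_hasSum hu hU n, ← map_smul]
      exact hD.trans (hL _ _ ih)
  ext s
  have hlim := (tendsto_tail_of_hasSum hU s).const_mul C
  rw [mul_zero] at hlim
  have := ge_of_tendsto' hlim fun n => h n s
  exact abs_eq_zero.1 (le_antisymm this (abs_nonneg _))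

end Orbit

/-! ### The linear system -/

section System

variable {S A : Type*} [Fintype S] [DecidableEq S] [Fintype A] {K : ℕ} {Factor : Fin K → Type*}
  (M : MDP S A K Factor) (π : Policy M)

/-- `stepOp` as a linear map. -/
def stepLin (F : S → A → S → ℝ) : (S → ℝ) →ₗ[ℝ] (S → ℝ) where
  toFun f := stepOp M π F f
  map_add' f g := by
    ext s
    simp only [stepOp, Pi.add_apply, ← Finset.sum_add_distrib]
    refine Finset.sum_congr rfl fun a _ => ?_
    split_ifs
    · simp
    · rw [← mul_add, ← Finset.sum_add_distrib]
      congr 1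
      exact Finset.sum_congr rfl fun _ _ => by ring
  map_smul' c f := by
    ext s
    simp only [stepOp, Pi.smul_apply, smul_eq_mul, Finset.mul_sum, RingHom.id_apply]
    refine Finset.sum_congr rfl fun a _ => ?_
    split_ifs
    · simp
    · rw [Finset.mul_sum]
      exact Finset.sum_congr rfl fun _ _ => by ring

theorem stepLin_apply (F : S → A → S → ℝ) (f : S → ℝ) (s : S) :
    stepLin M π F f s = stepOp M π F f s := rfl

theorem abs_stepOp_le {F G : S → A → S → ℝ} {f g : S → ℝ}
    (h : ∀ s, ∀ a ∈ M.avail s, ∀ s'', 0 < M.P s a s'' → |F s a s'' * f s''| ≤ G s a s'' * g s'')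
    (s : S) : |stepOp M π F f s| ≤ stepOp M π G g s := by
  refine (Finset.abs_sum_le_sum_abs _ _).trans (Finset.sum_le_sum fun a ha => ?_)
  split_ifs
  · simp
  rw [abs_mul, abs_of_nonneg (π.nonneg s a ha)]
  refine mul_le_mul_of_nonneg_left ?_ (π.nonneg s a ha)
  refine (Finset.abs_sum_le_sum_abs _ _).trans (Finset.sum_le_sum fun s'' _ => ?_)
  rw [abs_mul, abs_of_nonneg (M.P_nonneg s a ha s'')]
  rcases (M.P_nonneg s a ha s'').eq_or_lt with h0 | h0
  · simp [← h0]
  · exact mul_le_mul_of_nonneg_left (h s a ha s'' h0) h0.le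

theorem stepOp_one_mono {f g : S → ℝ} (h : f ≤ g) (s : S) :
    stepOp M π (fun _ _ _ => 1) f s ≤ stepOp M π (fun _ _ _ => 1) g s := by
  have h2 := abs_stepOp_le M π (F := fun _ _ _ => 1) (f := g - f)
    (G := fun _ _ _ => 1) (g := g - f)
    (fun s a _ s'' _ => by
      have := h s''
      rw [one_mul, Pi.sub_apply, abs_of_nonneg (sub_nonneg.2 this)]) s
  have h3 : stepOp M π (fun _ _ _ => 1) (g - f) s =
      stepOp M π (fun _ _ _ => 1) g s - stepOp M π (fun _ _ _ => 1) f s := by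
    rw [← stepLin_apply, map_sub]; rfl
  have := (abs_nonneg _).trans h2
  linarith

/-- The substochastic operator of the run before stopping. -/
def runLin (t : ℝ≥0∞) : (S → ℝ) →ₗ[ℝ] (S → ℝ) := (1 - stopProb t) • stepLin M π fun _ _ _ => 1

theorem runLin_mono {t : ℝ≥0∞} (ht : 1 ≤ t) (f g : S → ℝ) (h : f ≤ g) :
    runLin M π t f ≤ runLin M π t g := fun s =>
  mul_le_mul_of_nonneg_left (stepOp_one_mono M π h s) (sub_nonneg.2 (stopProb_le_one ht))

theorem massAt_succ_eq_runLin {t : ℝ≥0∞} (ht : 1 ≤ t) (s' : S) (n : ℕ) :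
    massAt M π (stopProb t) s' (n + 1) = runLin M π t (massAt M π (stopProb t) s' n) := by
  ext s
  exact massAt_succ M π (stopProb_nonneg t) (stopProb_le_one ht) s' n s

theorem hasSum_massAt_pi {t : ℝ≥0∞} (ht : 1 ≤ t) (s' : S) :
    HasSum (massAt M π (stopProb t) s') fun s => compP M π t s s' :=
  Pi.hasSum.2 fun s => hasSum_massAt M π ht s s'

theorem summable_mul_massAt {t : ℝ≥0∞} (ht : 1 ≤ t) (s' s : S) :
    Summable fun n : ℕ => ((n : ℝ) + 1) * massAt M π (stopProb t) s' n s :=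
  summable_mul_of_hasSum (runLin_mono M π ht)
    (fun n s => massAt_nonneg M π (stopProb_nonneg t) (stopProb_le_one ht) s' n s)
    (massAt_succ_eq_runLin M π ht s') (hasSum_massAt_pi M π ht s') s

/-- Expectation of `R_{0,τ}` on the event `{τ < ∞, S_τ = s'}`. -/
def totalReward (t : ℝ≥0∞) (s' s : S) : ℝ :=
  ∫ ω in stopsAt M s', stoppedReward M ω ∂runMeasure M π t s

theorem compP_eq {t : ℝ≥0∞} (ht : 1 ≤ t) (s' s : S) :
    compP M π t s s' = firstStep M π (stopProb t) s' (fun _ _ _ => 1) s +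
      (1 - stopProb t) * stepOp M π (fun _ _ _ => 1) (fun s => compP M π t s s') s := by
  have h := congrFun (map_tail_of_hasSum (massAt_succ_eq_runLin M π ht s')
    (hasSum_massAt_pi M π ht s') 0) s
  simp only [Finset.range_zero, Finset.sum_empty, sub_zero, zero_add, Finset.sum_range_one,
    Pi.sub_apply, massAt_zero M π (stopProb_nonneg t) (stopProb_le_one ht)] at h
  change (1 - stopProb t) * stepOp M π (fun _ _ _ => 1) (fun s => compP M π t s s') s = _ at h
  linarith

/-- Sum the recursion for the rewards over all times; the linear operators commute with the series
by continuity in finite dimension. -/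
theorem totalReward_eq {t : ℝ≥0∞} (ht : 1 ≤ t) (s' s : S) :
    totalReward M π t s' s = firstStep M π (stopProb t) s' M.R s +
      (1 - stopProb t) * (stepOp M π M.R (fun s => compP M π t s s') s +
        stepOp M π M.Γ (totalReward M π t s') s) := by
  have hW : HasSum (rewardAt M π (stopProb t) s') (totalReward M π t s') :=
    Pi.hasSum.2 fun s => hasSum_rewardAt M π ht s s' (summable_mul_massAt M π ht s' s)
  have h1 := (hasSum_nat_add_iff' 1).2 hW
  have h2 := (((stepLin M π M.R).toContinuousLinearMap.hasSum (hasSum_massAt_pi M π ht s')).add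
    ((stepLin M π M.Γ).toContinuousLinearMap.hasSum hW)).const_smul (1 - stopProb t)
  have e : (fun n => rewardAt M π (stopProb t) s' (n + 1)) = fun n => (1 - stopProb t) •
      ((stepLin M π M.R).toContinuousLinearMap (massAt M π (stopProb t) s' n) +
        (stepLin M π M.Γ).toContinuousLinearMap (rewardAt M π (stopProb t) s' n)) := by
    ext n s
    exact rewardAt_succ M π (stopProb_nonneg t) (stopProb_le_one ht) s' n s
  rw [e] at h1
  have h3 := h1.unique h2
  have h4 := congrFun h3 s
  simp only [Finset.sum_range_one, Pi.sub_apply,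
    rewardAt_zero M π (stopProb_nonneg t) (stopProb_le_one ht)] at h4
  change _ = (1 - stopProb t) * (stepOp M π M.R (fun s => compP M π t s s') s +
    stepOp M π M.Γ (totalReward M π t s') s) at h4
  linarith

theorem condReward_eq (t : ℝ≥0∞) (s s' : S) :
    condReward M π t s s' = (compP M π t s s')⁻¹ * totalReward M π t s' s := by
  rw [condReward, ProbabilityTheory.cond, integral_smul_measure, ENNReal.toReal_inv]
  rfl

theorem compP_nonneg (t : ℝ≥0∞) (s s' : S) : 0 ≤ compP M π t s s' := ENNReal.toReal_nonneg

/-- Off the support both sides vanish, since the integral is over a null set. The equations can thus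
be written on all of S. -/
theorem compP_mul_condReward {t : ℝ≥0∞} (ht : 1 ≤ t) (s s' : S) :
    compP M π t s s' * condReward M π t s s' = totalReward M π t s' s := by
  rw [condReward_eq]
  by_cases h : compP M π t s s' = 0
  · have := isProbabilityMeasure_runMeasure M π ht s
    have h0 : runMeasure M π t s (stopsAt M s') = 0 := by
      rcases (ENNReal.toReal_eq_zero_iff _).1 h with h | h
      · exact h
      · exact absurd h (measure_ne_top _ _)
    rw [totalReward, setIntegral_measure_zero _ h0]; simp
  · rw [mul_inv_cancel_left₀ h]

/-! ### Ending actions and terminal states -/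

theorem mem_endActions {a : A} : a ∈ M.endActions ↔ M.IsEnd a := by
  classical
  simp [MDP.endActions]

theorem endActions_subset (s : S) : M.endActions ⊆ M.avail s := fun a ha =>
  M.end_avail s a ((mem_endActions M).1 ha)

theorem prob_eq_zero_of_mem_term {s : S} (hs : s ∈ M.term) {a : A} (ha : a ∈ M.avail s)
    (hend : ¬ M.IsEnd a) : π.prob s a = 0 := by
  classical
  have h1 := Finset.sum_sdiff (f := π.prob s) (endActions_subset M s)
  rw [π.sum_eq_one, π.sum_end s hs, add_eq_right] at h1
  rw [Finset.sum_eq_zero_iff_of_nonneg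
    (fun b hb => π.nonneg s b (Finset.mem_sdiff.1 hb).1)] at h1
  exact h1 a (Finset.mem_sdiff.2 ⟨ha, fun h => hend ((mem_endActions M).1 h)⟩)

theorem stepOp_of_mem_term {s : S} (hs : s ∈ M.term) (F : S → A → S → ℝ) (f : S → ℝ) :
    stepOp M π F f s = 0 := by
  refine Finset.sum_eq_zero fun a ha => ?_
  split_ifs with h
  · rfl
  · rw [prob_eq_zero_of_mem_term M π hs ha h, zero_mul]

/-- A sum over the available actions splits into ending and other actions. -/
theorem sum_avail_ite (s : S) (f g : A → ℝ) [DecidablePred M.IsEnd] :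
    ∑ a ∈ M.avail s, (if M.IsEnd a then f a else g a) =
      ∑ a ∈ M.endActions, f a + ∑ a ∈ M.avail s, if M.IsEnd a then 0 else g a := by
  classical
  have h : ∑ a ∈ M.endActions, f a = ∑ a ∈ M.avail s, if M.IsEnd a then f a else 0 := by
    rw [← Finset.sum_filter]
    congr 1
    ext a
    rw [Finset.mem_filter, mem_endActions]
    exact ⟨fun h => ⟨M.end_avail s a h, h⟩, fun h => h.2⟩
  rw [h, ← Finset.sum_add_distrib]
  exact Finset.sum_congr rfl fun a _ => by split_ifs <;> simp

/-- Probability that the policy ends at `s`. -/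
def endProb (s : S) : ℝ := ∑ a ∈ M.endActions, π.prob s a

open Classical in
/-- The reward of an ending action. -/
def endReward (s : S) : ℝ := if s ∈ M.term then 0 else M.r

theorem P_mul_R_end (s : S) {a : A} (ha : M.IsEnd a) (s'' : S) :
    M.P s a s'' * M.R s a s'' = if s'' = s then endReward M s else 0 := by
  rw [M.P_end s a s'' ha]
  split_ifs with h
  · subst h
    have hpos : 0 < M.P s'' a s'' := by rw [M.P_end _ _ _ ha]; simp
    unfold endReward
    split_ifs with ht
    · rw [M.R_term s'' ht a (M.end_avail _ a ha) s'' hpos, mul_zero]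
    · rw [M.R_end s'' ht a ha s'' hpos, one_mul]
  · simp

theorem P_mul_Γ_end (s : S) {a : A} (ha : M.IsEnd a) (s'' : S) :
    M.P s a s'' * M.Γ s a s'' = if s'' = s then 1 else 0 := by
  rw [M.P_end s a s'' ha]
  split_ifs with h
  · subst h
    have hpos : 0 < M.P s'' a s'' := by rw [M.P_end _ _ _ ha]; simp
    rw [M.Γ_end s'' a ha s'' hpos, one_mul]
  · simp

/-- From a terminal state the policy ends at once, without moving. -/
theorem compP_of_mem_term {t : ℝ≥0∞} (ht : 1 ≤ t) {s : S} (hs : s ∈ M.term) (s' : S) :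
    compP M π t s s' = if s' = s then 1 else 0 := by
  classical
  rw [compP_eq M π ht, stepOp_of_mem_term M π hs, mul_zero, add_zero]
  have h : firstStep M π (stopProb t) s' (fun _ _ _ => 1) s =
      ∑ a ∈ M.avail s, if M.IsEnd a then π.prob s a * (if s' = s then 1 else 0) else 0 := by
    refine Finset.sum_congr rfl fun a ha => ?_
    split_ifs with h1 h2
    · rw [M.P_end s a s' h1, if_pos h2]; simp
    · rw [M.P_end s a s' h1, if_neg h2]; simp
    · simp [prob_eq_zero_of_mem_term M π hs ha h1]
  rw [h, sum_avail_ite, ← Finset.sum_mul, π.sum_end s hs]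
  simp

theorem totalReward_of_mem_term {t : ℝ≥0∞} (ht : 1 ≤ t) {s : S} (hs : s ∈ M.term) (s' : S) :
    totalReward M π t s' s = 0 := by
  rw [totalReward_eq M π ht, stepOp_of_mem_term M π hs, stepOp_of_mem_term M π hs]
  simp only [add_zero, mul_zero]
  refine Finset.sum_eq_zero fun a ha => ?_
  rcases (M.P_nonneg s a ha s').eq_or_lt with h | h
  · simp [← h]
  · simp [M.R_term s hs a ha s' h]

/-- At terminal states all relevant rewards vanish, so the prescribed value 0 agrees with the
conditional expectation. -/
theorem compR_eq_condReward {t : ℝ≥0∞} (ht : 1 ≤ t) (s s' : S) :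
    compR M π t s s' = condReward M π t s s' := by
  unfold compR
  split_ifs with h
  · rw [condReward_eq, totalReward_of_mem_term M π ht h, mul_zero]
  · rfl

/-- The weight 1 of an ending action is split as q + (1 - q): the first part completes the average
over all actions that the matrix with factor 1/t expresses, the second produces the diagonal
correction. -/
theorem firstStep_R (q : ℝ) (s' s : S) :
    firstStep M π q s' M.R s = q * ∑ a ∈ M.avail s, M.P s a s' * M.R s a s' * π.prob s a +
      (1 - q) * (if s' = s then endReward M s * endProb M π s else 0) := by
  classical
  have h : ∀ a, π.prob s a * (M.P s a s' * (M.R s a s' * if M.IsEnd a then 1 else q)) =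
      q * (M.P s a s' * M.R s a s' * π.prob s a) +
        if M.IsEnd a then (1 - q) * ((if s' = s then endReward M s else 0) * π.prob s a)
          else 0 := by
    intro a
    split_ifs with h1 h2
    · rw [show endReward M s = M.P s a s' * M.R s a s' by rw [P_mul_R_end M s h1, if_pos h2]]
      ring
    · rw [show M.P s a s' * (M.R s a s' * 1) = 0 by rw [mul_one, P_mul_R_end M s h1, if_neg h2],
        P_mul_R_end M s h1, if_neg h2]
      ring
    · ring
  unfold firstStep
  rw [Finset.sum_congr rfl fun a _ => h a, Finset.sum_add_distrib, ← Finset.mul_sum,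
    sum_avail_ite, ← Finset.mul_sum, ← Finset.mul_sum]
  split_ifs <;> simp [endProb]

/-! ### Row equations of the linear system -/

theorem endMatrix_apply (s s'' : S) :
    endMatrix M π s s'' = if s'' = s then endProb M π s else 0 := by
  change ∑ a ∈ M.endActions, M.P s a s'' * π.prob s a = _
  rw [Finset.sum_congr rfl fun a ha => by rw [M.P_end s a s'' ((mem_endActions M).1 ha)]]
  split_ifs <;> simp [endProb]

theorem sum_supp {t : ℝ≥0∞} {s' : S} (f : S → ℝ) (hf : ∀ s, f s ≠ 0 → 0 < compP M π t s s') :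
    ∑ s : Supp M π t s', f s = ∑ s, f s := by
  classical
  rw [← Finset.sum_filter_of_ne (p := fun s => 0 < compP M π t s s') fun s _ => hf s]
  exact (Finset.sum_subtype _ (by simp) f).symm

/-- Rows of the averaged Doob transform, split into ending and other actions. -/
theorem sum_hadamardAvg_doobP {t : ℝ≥0∞} {s' s : S} (hs : 0 < compP M π t s s')
    (F : S → A → S → ℝ) (c : ℝ)
    (hF : ∀ a, M.IsEnd a → ∀ s'', M.P s a s'' * F s a s'' = if s'' = s then c else 0)
    (g : S → ℝ) :
    compP M π t s s' * ∑ s'' : Supp M π t s', hadamardAvg M π (doobP M π t s') F s s'' * g s'' =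
      c * endProb M π s * (compP M π t s s' * g s) +
        stepOp M π F (fun s'' => compP M π t s'' s' * g s'') s := by
  classical
  have hh : ∀ s'', hadamardAvg M π (doobP M π t s') F s s'' * g s'' =
      ∑ a ∈ M.avail s, (M.P s a s'' * compP M π t s'' s' / compP M π t s s') * F s a s'' *
        π.prob s a * g s'' := by
    intro s''
    rw [← Finset.sum_mul]; rfl
  rw [sum_supp M π (fun s'' => hadamardAvg M π (doobP M π t s') F s s'' * g s'')]
  · simp only [hh]
    rw [Finset.sum_comm, Finset.mul_sum]
    have h1 : ∀ a ∈ M.avail s, compP M π t s s' *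
        ∑ s'', (M.P s a s'' * compP M π t s'' s' / compP M π t s s') * F s a s'' *
          π.prob s a * g s'' =
        if M.IsEnd a then π.prob s a * (c * (compP M π t s s' * g s)) else
          π.prob s a * ∑ s'', M.P s a s'' * (F s a s'' * (compP M π t s'' s' * g s'')) := by
      intro a _
      have h2 : compP M π t s s' *
          ∑ s'', (M.P s a s'' * compP M π t s'' s' / compP M π t s s') * F s a s'' *
            π.prob s a * g s'' =
          π.prob s a * ∑ s'', M.P s a s'' * F s a s'' * (compP M π t s'' s' * g s'') := by
        rw [Finset.mul_sum, Finset.mul_sum]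
        refine Finset.sum_congr rfl fun s'' _ => ?_
        field_simp
      rw [h2]
      split_ifs with h
      · congr 1
        simp [hF a h]
      · congr 1
        exact Finset.sum_congr rfl fun s'' _ => by ring
    rw [Finset.sum_congr rfl h1, sum_avail_ite, ← Finset.sum_mul]
    simp only [stepOp, endProb]
    ring
  -- Columns outside the support vanish because of the factor P⁺(s'', π, s').
  · intro s'' hne
    refine lt_of_le_of_ne (compP_nonneg M π t s'' s') fun h0 => hne ?_
    rw [hh]
    simp [← h0]

theorem restrictSq_endMatrix_mulVec {t : ℝ≥0∞} {s' : S} (h : Supp M π t s' → ℝ)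
    (s : Supp M π t s') :
    (restrictSq M π t s' (endMatrix M π) *ᵥ h) s = endProb M π s * h s := by
  change ∑ s'' : Supp M π t s', endMatrix M π s s'' * h s'' = _
  rw [Finset.sum_eq_single s]
  · rw [endMatrix_apply, if_pos rfl]
  · intro b _ hb
    rw [endMatrix_apply, if_neg fun h => hb (Subtype.ext h), zero_mul]
  · simp

theorem diagonal_inv_mulVec {ι : Type*} [Fintype ι] [DecidableEq ι] (d v : ι → ℝ)
    (hd : ∀ i, d i ≠ 0) (i : ι) : ((Matrix.diagonal d)⁻¹ *ᵥ v) i = (d i)⁻¹ * v i := by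
  have : (Matrix.diagonal d)⁻¹ = Matrix.diagonal fun i => (d i)⁻¹ := by
    refine Matrix.inv_eq_right_inv ?_
    rw [Matrix.diagonal_mul_diagonal, ← Matrix.diagonal_one]
    congr 1
    ext i
    exact mul_inv_cancel₀ (hd i)
  rw [this, Matrix.mulVec_diagonal]

/-- The linear system, multiplied by the compressed transition probabilities. -/
theorem solvesRewardSystem_iff {t : ℝ≥0∞} (ht : 1 ≤ t) (s' : S) (h : S → ℝ) :
    SolvesRewardSystem M π t s' (fun s => h s) ↔ ∀ s, 0 < compP M π t s s' →
      compP M π t s s' * h s = firstStep M π (stopProb t) s' M.R s +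
        (1 - stopProb t) * (stepOp M π M.R (fun s => compP M π t s s') s +
          stepOp M π M.Γ (fun s => compP M π t s s' * h s) s) := by
  classical
  unfold SolvesRewardSystem
  rw [funext_iff, Subtype.forall]
  refine forall_congr' fun s => forall_congr' fun hs => ?_
  have hΓ := sum_hadamardAvg_doobP M π hs M.Γ 1 (fun a ha s'' => P_mul_Γ_end M s ha s'') h
  have hR := sum_hadamardAvg_doobP M π hs M.R (endReward M s)
    (fun a ha s'' => P_mul_R_end M s ha s'') (fun _ => 1)
  have hbar : compP M π t s s' * hadamardAvg M π (doobPbar M π t s') M.R s s' =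
      ∑ a ∈ M.avail s, M.P s a s' * M.R s a s' * π.prob s a := by
    change _ * ∑ a ∈ M.avail s, M.P s a s' / compP M π t s s' * M.R s a s' * π.prob s a = _
    rw [Finset.mul_sum]
    exact Finset.sum_congr rfl fun a _ => by field_simp
  -- The system charges r for ending even at terminal states, where the reward is 0. This is
  -- harmless: there P⁺(s, π, s') is the indicator of s = s', so the two terms with r cancel.
  have hterm : (endReward M s - M.r) * endProb M π s *
      (compP M π t s s' - if s' = s then 1 else 0) = 0 := by
    by_cases hst : s ∈ M.term
    · rw [compP_of_mem_term M π ht hst]; simp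
    · simp [endReward, hst]
  simp only [Matrix.add_mulVec, Matrix.one_mulVec, Matrix.smul_mulVec, Matrix.sub_mulVec,
    Pi.add_apply, Pi.sub_apply, Pi.smul_apply, smul_eq_mul, restrictSq_endMatrix_mulVec,
    Pi.one_apply, mul_one, Matrix.mulVec_single_one,
    diagonal_inv_mulVec _ _ (fun s : Supp M π t s' => s.2.ne')]
  change h s + (1 - stopProb t) * (endProb M π s * h s -
      ∑ s'' : Supp M π t s', hadamardAvg M π (doobP M π t s') M.Γ s s'' * h s'') =
    (1 - stopProb t) * (∑ s'' : Supp M π t s', hadamardAvg M π (doobP M π t s') M.R s s'' * 1 -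
      M.r * endProb M π s + M.r * ((compP M π t s s')⁻¹ * endMatrix M π s s')) +
    stopProb t * hadamardAvg M π (doobPbar M π t s') M.R s s' ↔ _
  -- Multiplying the row by P⁺(s, π, s') ≠ 0 clears the denominators; the rest is linear in the
  -- identities above.
  rw [← mul_right_inj' hs.ne', firstStep_R, endMatrix_apply]
  have hinv : compP M π t s s' * (compP M π t s s')⁻¹ = 1 := mul_inv_cancel₀ hs.ne'
  have hδ : ∀ x : ℝ, (if s' = s then x else 0) = x * if s' = s then 1 else 0 := fun x => by
    split_ifs <;> simp
  rw [hδ (endReward M s * endProb M π s), hδ (endProb M π s)]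
  generalize (if s' = s then (1 : ℝ) else 0) = δ at hterm ⊢
  simp only [mul_one] at hR ⊢
  constructor
  · intro hg
    linear_combination hg + (1 - stopProb t) * hΓ + (1 - stopProb t) * hR + stopProb t * hbar +
      (1 - stopProb t) * hterm + (1 - stopProb t) * M.r * endProb M π s * δ * hinv
  · intro hg
    linear_combination hg - (1 - stopProb t) * hΓ - (1 - stopProb t) * hR - stopProb t * hbar -
      (1 - stopProb t) * hterm - (1 - stopProb t) * M.r * endProb M π s * δ * hinv

/-! ### Integrability and uniqueness -/

theorem integrable_stoppedReward_cond {t : ℝ≥0∞} (ht : 1 ≤ t) {s s' : S}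
    (hs : 0 < compP M π t s s') :
    Integrable (stoppedReward M)
      (ProbabilityTheory.cond (runMeasure M π t s) (stopsAt M s')) := by
  refine (integrableOn_stoppedReward M π ht s s' (summable_mul_massAt M π ht s' s)).smul_measure ?_
  rw [ENNReal.inv_ne_top]
  intro h
  rw [compP, h] at hs
  simp at hs

theorem eq_of_solvesRewardSystem {t : ℝ≥0∞} (ht : 1 ≤ t) (s' : S) {h k : S → ℝ}
    (hh : SolvesRewardSystem M π t s' fun s => h s)
    (hk : SolvesRewardSystem M π t s' fun s => k s) {s : S} (hs : 0 < compP M π t s s') :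
    h s = k s := by
  rw [solvesRewardSystem_iff M π ht] at hh hk
  set D : S → ℝ := fun s => compP M π t s s' * (h s - k s) with hD
  have hDeq : ∀ s, 0 < compP M π t s s' → D s = (1 - stopProb t) * stepOp M π M.Γ D s := by
    intro s hs
    have e : D = (fun s => compP M π t s s' * h s) - fun s => compP M π t s s' * k s := by
      ext s; simp [hD, mul_sub]
    have h1 : stepOp M π M.Γ D s = stepOp M π M.Γ (fun s => compP M π t s s' * h s) s -
        stepOp M π M.Γ (fun s => compP M π t s s' * k s) s := by
      rw [e, ← stepLin_apply, map_sub]; rfl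
    rw [h1]
    simp only [hD, mul_sub]
    rw [hh s hs, hk s hs]
    ring
  have hle : |D| ≤ runLin M π t |D| := by
    have habs : ∀ s, |stepOp M π M.Γ D s| ≤ stepOp M π (fun _ _ _ => 1) |D| s :=
      abs_stepOp_le M π fun s a ha s'' hP => by
        rw [abs_mul, abs_of_nonneg (M.Γ_nonneg s a ha s'' hP)]
        exact mul_le_mul_of_nonneg_right (M.Γ_le_one s a ha s'' hP) (abs_nonneg _)
    intro s
    have h0 : 0 ≤ 1 - stopProb t := sub_nonneg.2 (stopProb_le_one ht)
    have h1 := mul_le_mul_of_nonneg_left (habs s) h0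
    refine le_trans ?_ h1
    -- The equation is known only on the support, but D vanishes off it, so the inequality extends
    -- to all of S.
    rcases (compP_nonneg M π t s s').eq_or_lt with hs | hs
    · have : D s = 0 := by simp [hD, ← hs]
      rw [Pi.abs_apply, this, abs_zero]
      exact mul_nonneg h0 (abs_nonneg _)
    · rw [Pi.abs_apply, hDeq s hs, abs_mul, abs_of_nonneg h0]
  obtain ⟨C, hC⟩ := (Set.finite_range fun s => |h s - k s|).bddAbove
  have hbd : |D| ≤ C • fun s => compP M π t s s' := by
    intro s
    simp only [hD, Pi.abs_apply, abs_mul, abs_of_nonneg (compP_nonneg M π t s s'), Pi.smul_apply,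
      smul_eq_mul]
    rw [mul_comm]
    exact mul_le_mul_of_nonneg_right (hC ⟨s, rfl⟩) (compP_nonneg M π t s s')
  have h0 := congrFun (eq_zero_of_abs_le (runLin_mono M π ht) (massAt_succ_eq_runLin M π ht s')
    (hasSum_massAt_pi M π ht s') hle hbd) s
  exact sub_eq_zero.1 ((mul_eq_zero.1 h0).resolve_left hs.ne')

end System

end CompressMDP

end

open CompressMDP in
theorem mainTheorem8 {S A : Type*} [Fintype S] [DecidableEq S] [Fintype A]
    {K : ℕ} {Factor : Fin K → Type*} (M : MDP S A K Factor) (π : Policy M)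
    (t : ℝ≥0∞) (ht : 1 ≤ t) (s' : S) :
    (∀ s : Supp M π t s',
      MeasureTheory.Integrable (stoppedReward M)
        (ProbabilityTheory.cond (runMeasure M π t s) (stopsAt M s')) ∧
      compR M π t s s' = condReward M π t s s') ∧
    (∃ C : ℝ, ∀ s : Supp M π t s', |compR M π t s s'| ≤ C) ∧
    SolvesRewardSystem M π t s' (fun s : Supp M π t s' => compR M π t s s') ∧
    ∀ h : Supp M π t s' → ℝ, SolvesRewardSystem M π t s' h →
      h = fun s : Supp M π t s' => compR M π t s s' := by
  classical
  have hsolves : SolvesRewardSystem M π t s' (fun s : Supp M π t s' => compR M π t s s') := by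
    refine (solvesRewardSystem_iff M π ht s' fun s => compR M π t s s').2 fun s _ => ?_
    simp only [compR_eq_condReward M π ht, compP_mul_condReward M π ht]
    exact totalReward_eq M π ht s' s
  refine ⟨fun s => ⟨integrable_stoppedReward_cond M π ht s.2, compR_eq_condReward M π ht s s'⟩,
    ?_, hsolves, fun h hh => ?_⟩
  · obtain ⟨C, hC⟩ := (Set.finite_range fun s => |compR M π t s s'|).bddAbove
    exact ⟨C, fun s => hC ⟨s.1, rfl⟩⟩
  -- Extension by 0 is arbitrary: values off the support are always multiplied by P⁺ = 0.
  · set k : S → ℝ := fun s => if hs : 0 < compP M π t s s' then h ⟨s, hs⟩ else 0 with hk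
    have e : h = fun s : Supp M π t s' => k s := by
      ext s; simp [hk, s.2]
    rw [e] at hh ⊢
    ext s
    exact eq_of_solvesRewardSystem M π ht s' (h := k) (k := fun s => compR M π t s s')
      hh hsolves s.2
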